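/- Let $q$ be a prime power and call an $n$-tuple of distinct points of $\mathbb{P}^3(\mathbb{F}_q)$ an (ordered) $n$-cap if no three of its points lie on a line; let $c_{n,3}(q)$ be the number of ordered $n$-caps ($n!$ times the number of $n$-element caps). A planar space on a finite point set $\mathcal P$ consists of sets $\mathcal L,\mathcal H\subseteq 2^{\mathcal P}$ of lines and planes such that every line has at least two points, any two distinct points lie on exactly one line, any three distinct non-collinear points lie on exactly one plane, and every plane contains three non-collinear points. A line is full if it has at least three points, a plane is full if it has at least four points. Isomorphisms are bijections of the points preserving lines and planes. A hyperfiguration is a planar space, on at least one point, in which every point $P$ satisfies at least one of $i\ge 4$, $j\ge 3$, $(i,j)=(3,0)$, where $i$ and $j$ are the numbers of full planes and of full lines through $P$. A strong realization of a planar space $f$ is an injective map $\sigma:\mathcal P\to\mathbb P^3(\mathbb F_q)$ such that, for every $S\subseteq\mathcal P$, $\sigma(S)$ lies on a line if and only if $|S|\le 1$ or $S$ is contained in a line of $f$, and $\sigma(S)$ lies in a plane if and only if $|S|\le 1$ or $S$ is contained in a line or in a plane of $f$. Let $A_f(4,q)$ be the number of strong realizations of $f$; it depends only on the isomorphism class of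 $f$. **Theorem.** For every $n\ge 0$ there are polynomials $s(q)=s^{(n)}(q)$ and $s_h(q)=s^{(n)}_h(q)$ in $\mathbb Z[q]$ such that for every prime power $q$ $$c_{n,3}(q)=s(q)+\sum_h s_h(q)\,A_h(4,q),$$ where $h$ runs over the isomorphism classes of hyperfigurations on at most $n$ points. Moreover $s$ (from $n$) and $s_h$ (from $n$ and $h$) are produced by the following algorithm. 1. For each planar space $f$ on $m$ points, compute polynomials $r_f$ and $r_{f,h}$ in $\mathbb Z[q]$ such that $A_f(4,q)=r_f(q)+\sum_h r_{f,h}(q)A_h(4,q)$ for every prime power $q$, where $h$ runs over the isomorphism classes of hyperfigurations on at most $m$ points. (Such polynomials exist, and there is an algorithm that computes $r_f$ from $f$ and $r_{f,h}$ from $f$ and $h$.) 2. Output $s=\sum_f r_f$ and $s_h=\sum_f r_{f,h}$, where $f$ runs over the set $\mathcal N_n$ of planar spaces on the point set $\{0,\dots,n-1\}$ without full lines; here $c_{n,3}(q)=\sum_{f\in\mathcal N_n}A_f(4,q)$ for every prime power $q$. -/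

import Mathlib

open Polynomial

universe u

/-! ### Points, lines and planes of projective 3-space over a field -/

/-- Projective 3-space over `F`: the one-dimensional subspaces of `F⁴`. -/
abbrev P3 (F : Type u) [Field F] : Type u := Projectivization F (Fin 4 → F)

/-- The set of points `S` is contained in a `d`-dimensional projective subspace. -/
def ContainedInFlat {F : Type u} [Field F] (d : ℕ) (S : Set (P3 F)) : Prop :=
  ∃ W : Submodule F (Fin 4 → F), Module.finrank F W = d + 1 ∧ ∀ x ∈ S, x.submodule ≤ W

/-- `S` is contained in a line of projective 3-space. -/
def InLine {F : Type u} [Field F] (S : Set (P3 F)) : Prop := ContainedInFlat 1 S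

/-- `S` is contained in a plane of projective 3-space. -/
def InPlane {F : Type u} [Field F] (S : Set (P3 F)) : Prop := ContainedInFlat 2 S

/-- A cap: no three distinct points of `S` lie on a line. -/
def IsCap {F : Type u} [Field F] (S : Set (P3 F)) : Prop :=
  ∀ a ∈ S, ∀ b ∈ S, ∀ c ∈ S, a ≠ b → a ≠ c → b ≠ c → ¬ InLine ({a, b, c} : Set (P3 F))

/-- `c_{n,3}(q)`, the number of (ordered) `n`-caps: `n`-tuples of distinct points that form a cap.
This is `n!` times the number of `n`-element sets that are caps. -/
noncomputable def capCount (n : ℕ) (F : Type u) [Field F] : ℕ :=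
  Nat.card {v : Fin n → P3 F // Function.Injective v ∧ IsCap (Set.range v)}

/-! ### Planar spaces -/

/-- A planar space on the points `0, …, m - 1`. All lines (also those with two points) and all
planes (also those with three points) are listed; a plane is required not to be collinear. -/
@[ext]
structure PlanarSpace (m : ℕ) where
  lines : Finset (Finset (Fin m))
  planes : Finset (Finset (Fin m))
  two_le_card_line : ∀ L ∈ lines, 2 ≤ L.card
  existsUnique_line : ∀ a b : Fin m, a ≠ b → ∃! L, L ∈ lines ∧ a ∈ L ∧ b ∈ L
  existsUnique_plane : ∀ a b c : Fin m, a ≠ b → a ≠ c → b ≠ c →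
    (¬ ∃ L ∈ lines, a ∈ L ∧ b ∈ L ∧ c ∈ L) → ∃! H, H ∈ planes ∧ a ∈ H ∧ b ∈ H ∧ c ∈ H
  plane_noncollinear : ∀ H ∈ planes, 3 ≤ H.card ∧ ∀ L ∈ lines, ¬ H ⊆ L

namespace PlanarSpace

variable {m : ℕ}

/-- `S` lies on a line of the planar space (at most one point is always collinear). -/
def Collinear (f : PlanarSpace m) (S : Finset (Fin m)) : Prop :=
  S.card ≤ 1 ∨ ∃ L ∈ f.lines, S ⊆ L

/-- `S` lies on a plane of the planar space, or is already collinear. -/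
def Coplanar (f : PlanarSpace m) (S : Finset (Fin m)) : Prop :=
  f.Collinear S ∨ ∃ H ∈ f.planes, S ⊆ H

/-- Strong realizations: injective maps to projective 3-space under which exactly the collinear
sets become collinear, and exactly the coplanar sets become coplanar. -/
structure IsStrongRealization (f : PlanarSpace m) {F : Type u} [Field F] (σ : Fin m → P3 F) :
    Prop where
  injective : Function.Injective σ
  inLine_iff : ∀ S : Finset (Fin m), InLine (σ '' (S : Set (Fin m))) ↔ f.Collinear S
  inPlane_iff : ∀ S : Finset (Fin m), InPlane (σ '' (S : Set (Fin m))) ↔ f.Coplanar S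

/-- `A_f(4, q)`, the number of strong realizations of `f` in projective 3-space over `F`. -/
noncomputable def realizationCount (f : PlanarSpace m) (F : Type u) [Field F] : ℕ :=
  Nat.card {σ : Fin m → P3 F // f.IsStrongRealization σ}

/-- The number of full planes (planes with at least four points) through `p`. -/
def planeIndex (f : PlanarSpace m) (p : Fin m) : ℕ :=
  (f.planes.filter fun H => p ∈ H ∧ 4 ≤ H.card).card

/-- The number of full lines (lines with at least three points) through `p`. -/
def lineIndex (f : PlanarSpace m) (p : Fin m) : ℕ :=
  (f.lines.filter fun L => p ∈ L ∧ 3 ≤ L.card).card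

/-- The index condition that defines hyperfigurations. -/
def IsHyperfiguration (f : PlanarSpace m) : Prop :=
  ∀ p : Fin m, 4 ≤ f.planeIndex p ∨ 3 ≤ f.lineIndex p ∨ (f.planeIndex p = 3 ∧ f.lineIndex p = 0)

/-- Isomorphism: a bijection of the points that preserves lines and planes. -/
def Isomorphic (f g : PlanarSpace m) : Prop :=
  ∃ ρ : Equiv.Perm (Fin m), ∀ S : Finset (Fin m),
    (S.map ρ.toEmbedding ∈ g.lines ↔ S ∈ f.lines) ∧
    (S.map ρ.toEmbedding ∈ g.planes ↔ S ∈ f.planes)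

theorem Isomorphic.refl (f : PlanarSpace m) : f.Isomorphic f :=
  ⟨Equiv.refl _, fun S => by simp⟩

theorem Isomorphic.symm {f g : PlanarSpace m} (h : f.Isomorphic g) : g.Isomorphic f := by
  obtain ⟨ρ, hρ⟩ := h
  refine ⟨ρ.symm, fun S => ?_⟩
  have h1 := hρ (S.map ρ.symm.toEmbedding)
  have h2 : (S.map ρ.symm.toEmbedding).map ρ.toEmbedding = S := by ext; simp
  rw [h2] at h1
  exact ⟨h1.1.symm, h1.2.symm⟩

theorem Isomorphic.trans {f g k : PlanarSpace m} (h : f.Isomorphic g) (h' : g.Isomorphic k) :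
    f.Isomorphic k := by
  obtain ⟨ρ, hρ⟩ := h
  obtain ⟨τ, hτ⟩ := h'
  refine ⟨ρ.trans τ, fun S => ?_⟩
  have h2 : S.map (ρ.trans τ).toEmbedding = (S.map ρ.toEmbedding).map τ.toEmbedding := by
    rw [Finset.map_map]; rfl
  rw [h2]
  exact ⟨(hτ _).1.trans (hρ S).1, (hτ _).2.trans (hρ S).2⟩

theorem Isomorphic.collinear {f g : PlanarSpace m} {ρ : Equiv.Perm (Fin m)}
    (hρ : ∀ S : Finset (Fin m), S.map ρ.toEmbedding ∈ g.lines ↔ S ∈ f.lines)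
    (S : Finset (Fin m)) : g.Collinear (S.map ρ.toEmbedding) ↔ f.Collinear S := by
  unfold Collinear
  rw [Finset.card_map]
  refine or_congr Iff.rfl ⟨?_, ?_⟩
  · rintro ⟨L, hL, hS⟩
    have h2 : (L.map ρ.symm.toEmbedding).map ρ.toEmbedding = L := by ext; simp
    refine ⟨L.map ρ.symm.toEmbedding, (hρ _).1 (by rwa [h2]), ?_⟩
    rwa [← h2, Finset.map_subset_map] at hS
  · rintro ⟨L, hL, hS⟩
    exact ⟨L.map ρ.toEmbedding, (hρ _).2 hL, Finset.map_subset_map.2 hS⟩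

theorem Isomorphic.coplanar {f g : PlanarSpace m} {ρ : Equiv.Perm (Fin m)}
    (hρ : ∀ S : Finset (Fin m), (S.map ρ.toEmbedding ∈ g.lines ↔ S ∈ f.lines) ∧
      (S.map ρ.toEmbedding ∈ g.planes ↔ S ∈ f.planes))
    (S : Finset (Fin m)) : g.Coplanar (S.map ρ.toEmbedding) ↔ f.Coplanar S := by
  unfold Coplanar
  refine or_congr (Isomorphic.collinear (fun T => (hρ T).1) S) ⟨?_, ?_⟩
  · rintro ⟨L, hL, hS⟩
    have h2 : (L.map ρ.symm.toEmbedding).map ρ.toEmbedding = L := by ext; simp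
    refine ⟨L.map ρ.symm.toEmbedding, (hρ _).2.1 (by rwa [h2]), ?_⟩
    rwa [← h2, Finset.map_subset_map] at hS
  · rintro ⟨L, hL, hS⟩
    exact ⟨L.map ρ.toEmbedding, (hρ _).2.2 hL, Finset.map_subset_map.2 hS⟩

theorem Isomorphic.realizationCount_eq {f g : PlanarSpace m} (h : f.Isomorphic g)
    (F : Type u) [Field F] : f.realizationCount F = g.realizationCount F := by
  obtain ⟨ρ, hρ⟩ := h
  refine Nat.card_congr ((ρ.arrowCongr (Equiv.refl (P3 F))).subtypeEquiv fun σ => ?_)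
  have key : ∀ S : Finset (Fin m),
      (σ ∘ ρ.symm) '' ((S.map ρ.toEmbedding : Finset (Fin m)) : Set (Fin m)) =
        σ '' (S : Set (Fin m)) := by
    intro S
    ext x
    constructor
    · rintro ⟨y, hy, rfl⟩
      exact ⟨ρ.symm y, by simpa using hy, rfl⟩
    · rintro ⟨y, hy, rfl⟩
      exact ⟨ρ y, by simpa using hy, by simp⟩
  have surj : ∀ T : Finset (Fin m), ∃ S : Finset (Fin m), S.map ρ.toEmbedding = T :=
    fun T => ⟨T.map ρ.symm.toEmbedding, by ext; simp⟩
  change f.IsStrongRealization σ ↔ g.IsStrongRealization (σ ∘ ρ.symm)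
  constructor
  · intro hσ
    refine ⟨hσ.injective.comp ρ.symm.injective, fun T => ?_, fun T => ?_⟩
    · obtain ⟨S, rfl⟩ := surj T
      rw [key, Isomorphic.collinear (fun T => (hρ T).1), hσ.inLine_iff]
    · obtain ⟨S, rfl⟩ := surj T
      rw [key, Isomorphic.coplanar hρ, hσ.inPlane_iff]
  · intro hσ
    refine ⟨?_, fun S => ?_, fun S => ?_⟩
    · have := hσ.injective.comp ρ.injective
      rwa [Function.comp_assoc, Equiv.symm_comp_self, Function.comp_id] at this
    · rw [← key, hσ.inLine_iff, Isomorphic.collinear (fun T => (hρ T).1)]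
    · rw [← key, hσ.inPlane_iff, Isomorphic.coplanar hρ]

instance : Finite (PlanarSpace m) :=
  Finite.of_injective (fun f : PlanarSpace m => (f.lines, f.planes)) fun f g h => by
    simp only [Prod.mk.injEq] at h
    exact PlanarSpace.ext h.1 h.2

noncomputable instance : Fintype (PlanarSpace m) := Fintype.ofFinite _

open Classical in
/-- The planar spaces on `0, …, n - 1` without full lines. -/
noncomputable def withoutFullLines (n : ℕ) : Finset (PlanarSpace n) :=
  Finset.univ.filter fun f => ∀ L ∈ f.lines, L.card ≤ 2

end PlanarSpace

/-! ### Hyperfigurations up to isomorphism -/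

/-- Hyperfigurations on the points `0, …, k - 1`. -/
abbrev Hyperfiguration (k : ℕ) : Type := {f : PlanarSpace k // f.IsHyperfiguration}

instance hyperfigurationSetoid (k : ℕ) : Setoid (Hyperfiguration k) where
  r f g := f.1.Isomorphic g.1
  iseqv := ⟨fun f => .refl f.1, fun h => h.symm, fun h h' => h.trans h'⟩

/-- Isomorphism classes of hyperfigurations on `k` points. -/
def HyperfigurationClass (k : ℕ) : Type := Quotient (hyperfigurationSetoid k)

namespace HyperfigurationClass

/-- The isomorphism class of a hyperfiguration. -/
def mk {k : ℕ} (h : Hyperfiguration k) : HyperfigurationClass k := Quotient.mk _ h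

/-- `A_h(4, q)` for an isomorphism class `h`. -/
noncomputable def realizationCount {k : ℕ} (h : HyperfigurationClass k) (F : Type u) [Field F] :
    ℕ :=
  Quotient.lift (fun f : Hyperfiguration k => f.1.realizationCount F)
    (fun _ _ hfg => PlanarSpace.Isomorphic.realizationCount_eq hfg F) h

instance (k : ℕ) : Finite (HyperfigurationClass k) :=
  inferInstanceAs (Finite (Quotient (hyperfigurationSetoid k)))

noncomputable instance (k : ℕ) : Fintype (HyperfigurationClass k) := Fintype.ofFinite _

end HyperfigurationClass

/-- For polynomials `p` and `p_h`, one for each isomorphism class `h` of hyperfigurations, the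
value of `p(q) + ∑ h, p_h(q) A_h(4, q)` at `q = #F`, where `h` runs over the isomorphism classes of
(nonempty) hyperfigurations on at most `n` points. -/
noncomputable def hyperfigurationSum (n : ℕ) (p : ℤ[X])
    (ph : ∀ k : ℕ, HyperfigurationClass k → ℤ[X]) (F : Type u) [Field F] [Fintype F] : ℤ :=
  p.eval (Fintype.card F : ℤ) +
    ∑ k ∈ Finset.Icc 1 n, ∑ h : HyperfigurationClass k,
      (ph k h).eval (Fintype.card F : ℤ) * (h.realizationCount F : ℤ)

/-! ### Algorithms that output integer polynomials -/

/-- The members of a family of subsets of `0, …, m - 1`, as a list of increasing lists of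
numbers. -/
def familyCode {m : ℕ} (𝓢 : Finset (Finset (Fin m))) : List (List ℕ) :=
  ((List.finRange m).sublists.filter fun l => l.toFinset ∈ 𝓢).map fun l => l.map Fin.val

/-- A planar space as input of an algorithm: the number of points, the lines, the planes. -/
def PlanarSpace.code {m : ℕ} (f : PlanarSpace m) : ℕ × List (List ℕ) × List (List ℕ) :=
  (m, familyCode f.lines, familyCode f.planes)

/-- The polynomial with the listed coefficients, constant term first. -/
noncomputable def polyOfCoeffs (l : List ℤ) : ℤ[X] :=
  l.foldr (fun a p => C a + X * p) 0

/-- Some algorithm computes, from the code of an object `b`, the coefficients of the polynomial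
`p b`. -/
def AlgorithmicallyComputable {α β : Type} [Primcodable α] (code : β → α) (p : β → ℤ[X]) : Prop :=
  ∃ φ : α → List ℤ, Computable φ ∧ ∀ b : β, polyOfCoeffs (φ (code b)) = p b

/-!
A planar space has strong realizations only if dependencies persist in larger sets of points. Such
a space is a hyperfiguration unless some point `P` satisfies few incidence conditions: the flats
through `P` spanned by other points are then cut out by at most two of them, so the rank `d` of
their intersection, the locus of `P`, is the same in all realizations. A realization of the space
without `P` extends by every point of the locus that is not yet taken, in
`(q ^ d - 1) / (q - 1) - #{Q | Q lies on the locus}` ways, to a realization of the given space or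
of one of its degenerations, in which `P` has moved to a more special position and more sets of
points are dependent. This expresses `A_f(4, q)` by the counts of spaces with fewer points or
smaller ranks, and the recursion ends in hyperfigurations and in the empty space, which has exactly
one realization.

Caps are the strong realizations of the planar spaces without full lines. All steps are searches
through finite lists, hence primitive recursive.
-/

section ProjectiveSpan

open scoped LinearAlgebra.Projectivization

variable {K V ι : Type*} [DivisionRing K] [AddCommGroup V] [Module K V]

/-- The vector subspace spanned by the points `σ i` with `i ∈ S`. -/
def pointSpan (σ : ι → ℙ K V) (S : Finset ι) : Submodule K V := S.sup fun i ↦ (σ i).submodule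

/-- The rank of the points `σ i` with `i ∈ S`: one more than the projective dimension of their
span. -/
noncomputable def pointRank (σ : ι → ℙ K V) (S : Finset ι) : ℕ := Module.finrank K (pointSpan σ S)

instance (x : ℙ K V) : FiniteDimensional K x.submodule :=
  .of_finrank_pos (x.finrank_submodule.symm ▸ one_pos)

instance (σ : ι → ℙ K V) (S : Finset ι) : FiniteDimensional K (pointSpan σ S) :=
  inferInstanceAs (FiniteDimensional K ↥(S.sup fun i ↦ (σ i).submodule))

theorem submodule_le_submodule_iff {x y : ℙ K V} : x.submodule ≤ y.submodule ↔ x = y := by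
  refine ⟨fun h ↦ Projectivization.submodule_injective ?_, fun h ↦ h ▸ le_rfl⟩
  exact Submodule.eq_of_le_of_finrank_eq h (x.finrank_submodule.trans y.finrank_submodule.symm)

variable {σ : ι → ℙ K V} {S T : Finset ι}

theorem submodule_le_pointSpan {i : ι} (h : i ∈ S) : (σ i).submodule ≤ pointSpan σ S :=
  Finset.le_sup (f := fun i ↦ (σ i).submodule) h

theorem pointSpan_mono (h : S ⊆ T) : pointSpan σ S ≤ pointSpan σ T := Finset.sup_mono h

theorem pointSpan_map {κ : Type*} (e : κ ↪ ι) (S : Finset κ) :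
    pointSpan σ (S.map e) = pointSpan (σ ∘ e) S := Finset.sup_map ..

theorem pointRank_map {κ : Type*} (e : κ ↪ ι) (S : Finset κ) :
    pointRank σ (S.map e) = pointRank (σ ∘ e) S := by
  rw [pointRank, pointSpan_map, pointRank]

theorem pointRank_mono (h : S ⊆ T) : pointRank σ S ≤ pointRank σ T :=
  Submodule.finrank_mono (pointSpan_mono h)

theorem pointRank_le_finrank [FiniteDimensional K V] : pointRank σ S ≤ Module.finrank K V :=
  (pointSpan σ S).finrank_le

theorem pointSpan_eq_of_pointRank_le (h : S ⊆ T) (h' : pointRank σ T ≤ pointRank σ S) :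
    pointSpan σ S = pointSpan σ T :=
  Submodule.eq_of_le_of_finrank_le (pointSpan_mono h) h'

theorem pointRank_empty : pointRank σ ∅ = 0 := finrank_bot K V

theorem pointRank_singleton (i : ι) : pointRank σ {i} = 1 := by
  rw [pointRank, pointSpan, Finset.sup_singleton, (σ i).finrank_submodule]

section

variable [DecidableEq ι]

theorem pointSpan_insert (i : ι) (S : Finset ι) :
    pointSpan σ (insert i S) = (σ i).submodule ⊔ pointSpan σ S := Finset.sup_insert

theorem pointSpan_union : pointSpan σ (S ∪ T) = pointSpan σ S ⊔ pointSpan σ T := Finset.sup_union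

theorem pointRank_insert_le (i : ι) : pointRank σ (insert i S) ≤ pointRank σ S + 1 := by
  have h := Submodule.finrank_add_le_finrank_add_finrank (σ i).submodule (pointSpan σ S)
  rwa [← pointSpan_insert, (σ i).finrank_submodule, add_comm] at h

theorem submodule_le_pointSpan_iff {i : ι} :
    (σ i).submodule ≤ pointSpan σ S ↔ pointRank σ (insert i S) = pointRank σ S := by
  constructor <;> intro h
  · rw [pointRank, pointSpan_insert, sup_eq_right.2 h, pointRank]
  · rw [pointSpan_eq_of_pointRank_le (Finset.subset_insert i S) h.le]
    exact submodule_le_pointSpan (Finset.mem_insert_self i S)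

theorem pointRank_pair_eq_two_iff {a b : ι} : pointRank σ {a, b} = 2 ↔ σ a ≠ σ b := by
  have hle := pointRank_insert_le (σ := σ) (S := {b}) a
  have hge := pointRank_mono (σ := σ) (Finset.subset_insert a {b})
  have hiff : σ a = σ b ↔ pointRank σ {a, b} = pointRank σ {b} := by
    rw [← submodule_le_pointSpan_iff, pointSpan, Finset.sup_singleton, submodule_le_submodule_iff]
  rw [pointRank_singleton] at hle hge hiff
  rw [ne_eq, hiff]
  lia

end

theorem pointRank_le_card : pointRank σ S ≤ S.card := by
  classical
  induction S using Finset.induction_on with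
  | empty => exact pointRank_empty.le
  | insert i S hi ih =>
    rw [Finset.card_insert_of_notMem hi]
    exact (pointRank_insert_le i).trans (Nat.add_le_add_right ih 1)

theorem two_le_pointRank (hσ : Function.Injective σ) (hS : 2 ≤ S.card) : 2 ≤ pointRank σ S := by
  classical
  obtain ⟨a, ha, b, hb, hab⟩ := Finset.one_lt_card.1 hS
  rw [← pointRank_pair_eq_two_iff.2 (hσ.ne hab)]
  exact pointRank_mono (by simp [Finset.insert_subset_iff, ha, hb])

theorem injective_of_two_le_pointRank (h : ∀ S : Finset ι, 2 ≤ S.card → 2 ≤ pointRank σ S) :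
    Function.Injective σ := by
  classical
  intro a b hab
  by_contra hne
  have hge := h {a, b} (Finset.card_pair hne).ge
  have hle := (pointRank_le_card (σ := σ) (S := {a, b})).trans_eq (Finset.card_pair hne)
  exact pointRank_pair_eq_two_iff.1 (hle.antisymm hge) hab

section PointFlat

variable [Fintype ι]

open Classical in
/-- The indices of the points in the span of the points `σ i` with `i ∈ S`. -/
noncomputable def pointClosure (σ : ι → ℙ K V) (S : Finset ι) : Finset ι :=
  Finset.univ.filter fun i ↦ (σ i).submodule ≤ pointSpan σ S

/-- `C` consists of all indices `i` for which `σ i` lies in a given flat, and the points `σ i` with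
`i ∈ C` span a flat of rank `k`. -/
def IsPointFlat (σ : ι → ℙ K V) (k : ℕ) (C : Finset ι) : Prop :=
  pointRank σ C = k ∧ pointClosure σ C = C

theorem mem_pointClosure {i : ι} :
    i ∈ pointClosure σ S ↔ (σ i).submodule ≤ pointSpan σ S := by
  simp [pointClosure]

theorem subset_pointClosure : S ⊆ pointClosure σ S := fun _ hi ↦
  mem_pointClosure.2 (submodule_le_pointSpan hi)

theorem pointSpan_pointClosure : pointSpan σ (pointClosure σ S) = pointSpan σ S :=
  le_antisymm (Finset.sup_le fun _ hi ↦ mem_pointClosure.1 hi) (pointSpan_mono subset_pointClosure)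

theorem pointClosure_eq_of_pointSpan_eq (h : pointSpan σ S = pointSpan σ T) :
    pointClosure σ S = pointClosure σ T := by
  ext i
  rw [mem_pointClosure, mem_pointClosure, h]

theorem isPointFlat_pointClosure : IsPointFlat σ (pointRank σ S) (pointClosure σ S) :=
  ⟨by rw [pointRank, pointSpan_pointClosure, pointRank],
    pointClosure_eq_of_pointSpan_eq pointSpan_pointClosure⟩

theorem IsPointFlat.eq_pointClosure {C : Finset ι} (hC : IsPointFlat σ (pointRank σ S) C)
    (h : S ⊆ C) : C = pointClosure σ S := by
  rw [← hC.2, pointClosure_eq_of_pointSpan_eq (pointSpan_eq_of_pointRank_le h hC.1.le)]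

theorem existsUnique_isPointFlat_superset (σ : ι → ℙ K V) (S : Finset ι) :
    ∃! C, IsPointFlat σ (pointRank σ S) C ∧ S ⊆ C :=
  ⟨pointClosure σ S, ⟨isPointFlat_pointClosure, subset_pointClosure⟩,
    fun _ h ↦ h.1.eq_pointClosure h.2⟩

end PointFlat

theorem exists_submodule_le_finrank_eq [FiniteDimensional K V] (W : Submodule K V) {d : ℕ}
    (hW : Module.finrank K W ≤ d) (hd : d ≤ Module.finrank K V) :
    ∃ W', W ≤ W' ∧ Module.finrank K W' = d := by
  induction d, hW using Nat.le_induction with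
  | base => exact ⟨W, le_rfl, rfl⟩
  | succ d _ ih =>
    obtain ⟨W', hW, rfl⟩ := ih (by lia)
    obtain ⟨v, -, hv⟩ := SetLike.exists_of_lt (Submodule.lt_top_of_finrank_lt_finrank hd)
    exact ⟨W' ⊔ Submodule.span K {v}, hW.trans le_sup_left, Submodule.finrank_sup_span_singleton hv⟩

theorem card_submodule_le [Finite K] (W : Submodule K V) :
    Nat.card {x : ℙ K V // x.submodule ≤ W} =
      ∑ i ∈ Finset.range (Module.finrank K W), Nat.card K ^ i := by
  let inclusion : ℙ K W → ℙ K V := Projectivization.map W.subtype W.injective_subtype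
  have inclusion_le (y : ℙ K W) : (inclusion y).submodule ≤ W := by
    cases y with | h v hv =>
    rw [show inclusion _ = _ from Projectivization.map_mk .., Projectivization.submodule_mk,
      Submodule.span_singleton_le_iff_mem]
    exact v.2
  rw [← Projectivization.card_of_finrank K W rfl]
  refine (Nat.card_congr <| .ofBijective (fun y ↦ ⟨inclusion y, inclusion_le y⟩) ⟨?_, ?_⟩).symm
  · exact fun y z h ↦ Projectivization.map_injective W.subtype W.injective_subtype
      (congrArg Subtype.val h)
  · rintro ⟨x, hx⟩
    cases x with | h v hv =>
    rw [Projectivization.submodule_mk, Submodule.span_singleton_le_iff_mem] at hx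
    exact ⟨.mk K ⟨v, hx⟩ fun h ↦ hv (congrArg Subtype.val h), rfl⟩

end ProjectiveSpan

theorem containedInFlat_image_iff {F : Type u} [Field F] {ι : Type*} {σ : ι → P3 F}
    {S : Finset ι} {d : ℕ} (hd : d ≤ 3) :
    ContainedInFlat d (σ '' S) ↔ pointRank σ S ≤ d + 1 := by
  simp only [ContainedInFlat, Set.forall_mem_image]
  constructor
  · rintro ⟨W, hW, h⟩
    exact hW ▸ Submodule.finrank_mono (Finset.sup_le @h)
  · intro h
    obtain ⟨W, hW, hWd⟩ := exists_submodule_le_finrank_eq _ h (by simpa [Nat.lt_succ_iff] using hd)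
    exact ⟨W, hWd, fun i hi ↦ (submodule_le_pointSpan hi).trans hW⟩

namespace PlanarSpace

section Rank

variable {m : ℕ} {f g : PlanarSpace m} {S T : Finset (Fin m)}

open Classical in
/-- The rank of a set of points of a planar space: one more than the dimension of its span. -/
noncomputable def rank (f : PlanarSpace m) (S : Finset (Fin m)) : ℕ :=
  if S.card ≤ 1 then S.card else if f.Collinear S then 2 else if f.Coplanar S then 3 else 4

theorem Collinear.subset (h : f.Collinear T) (hST : S ⊆ T) : f.Collinear S :=
  h.imp (Finset.card_le_card hST).trans fun ⟨L, hL, hT⟩ ↦ ⟨L, hL, hST.trans hT⟩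

theorem Coplanar.subset (h : f.Coplanar T) (hST : S ⊆ T) : f.Coplanar S :=
  h.imp (·.subset hST) fun ⟨H, hH, hT⟩ ↦ ⟨H, hH, hST.trans hT⟩

theorem rank_le_four : f.rank S ≤ 4 := by
  unfold rank; split_ifs <;> lia

theorem rank_of_card_le_one (h : S.card ≤ 1) : f.rank S = S.card := if_pos h

theorem rank_le_one_iff : f.rank S ≤ 1 ↔ S.card ≤ 1 := by
  unfold rank; split_ifs <;> lia

theorem rank_le_two_iff : f.rank S ≤ 2 ↔ f.Collinear S := by
  unfold rank
  split_ifs with h1 h2 h3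
  · exact iff_of_true (by lia) (.inl h1)
  all_goals simp [h2]

theorem rank_le_three_iff : f.rank S ≤ 3 ↔ f.Coplanar S := by
  unfold rank
  split_ifs with h1 h2 h3
  · exact iff_of_true (by lia) (.inl (.inl h1))
  · exact iff_of_true (by lia) (.inl h2)
  all_goals simp [h3]

theorem two_le_rank (h : 2 ≤ S.card) : 2 ≤ f.rank S :=
  not_le.1 (rank_le_one_iff.not.2 (not_le.2 h))

theorem rank_eq_two_iff : f.rank S = 2 ↔ f.Collinear S ∧ 2 ≤ S.card := by
  have h1 := rank_le_one_iff (f := f) (S := S)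
  rw [← rank_le_two_iff]
  lia

theorem rank_eq_three_iff : f.rank S = 3 ↔ f.Coplanar S ∧ ¬ f.Collinear S := by
  rw [← rank_le_two_iff, ← rank_le_three_iff]
  lia

theorem rank_mono (h : S ⊆ T) : f.rank S ≤ f.rank T := by
  by_cases hT : T.card ≤ 1
  · rw [rank_of_card_le_one hT, rank_of_card_le_one ((Finset.card_le_card h).trans hT)]
    exact Finset.card_le_card h
  have h2 : f.rank T ≤ 2 → f.rank S ≤ 2 := by
    simpa only [rank_le_two_iff] using (·.subset h)
  have h3 : f.rank T ≤ 3 → f.rank S ≤ 3 := by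
    simpa only [rank_le_three_iff] using (·.subset h)
  have h4 := rank_le_four (f := f) (S := S)
  have hT2 := two_le_rank (f := f) (not_le.1 hT)
  lia

theorem collinear_of_subset_line {L : Finset (Fin m)} (hL : L ∈ f.lines) (h : S ⊆ L) :
    f.Collinear S := .inr ⟨L, hL, h⟩

theorem not_collinear_of_mem_planes {H : Finset (Fin m)} (hH : H ∈ f.planes) :
    ¬ f.Collinear H := by
  rintro (h | ⟨L, hL, h⟩)
  · exact absurd (f.plane_noncollinear H hH).1 (by lia)
  · exact (f.plane_noncollinear H hH).2 L hL h

theorem line_eq_of_mem {L L' : Finset (Fin m)} (hL : L ∈ f.lines) (hL' : L' ∈ f.lines)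
    {a b : Fin m} (hab : a ≠ b) (ha : a ∈ L) (hb : b ∈ L) (ha' : a ∈ L') (hb' : b ∈ L') :
    L = L' :=
  (f.existsUnique_line a b hab).unique ⟨hL, ha, hb⟩ ⟨hL', ha', hb'⟩

theorem exists_triple_of_not_collinear (h : ¬ f.Collinear S) :
    ∃ a ∈ S, ∃ b ∈ S, ∃ c ∈ S, a ≠ b ∧ a ≠ c ∧ b ≠ c ∧
      ¬ ∃ L ∈ f.lines, a ∈ L ∧ b ∈ L ∧ c ∈ L := by
  obtain ⟨a, ha, b, hb, hab⟩ := Finset.one_lt_card.1 (not_le.1 fun hS ↦ h (.inl hS))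
  obtain ⟨L, ⟨hL, haL, hbL⟩, -⟩ := f.existsUnique_line a b hab
  obtain ⟨c, hc, hcL⟩ := Finset.not_subset.1 fun hSL ↦ h (.inr ⟨L, hL, hSL⟩)
  refine ⟨a, ha, b, hb, c, hc, hab, fun e ↦ hcL (e ▸ haL), fun e ↦ hcL (e ▸ hbL), ?_⟩
  rintro ⟨L', hL', haL', hbL', hcL'⟩
  exact hcL (line_eq_of_mem hL hL' hab haL hbL haL' hbL' ▸ hcL')

theorem three_le_card_of_not_collinear (h : ¬ f.Collinear S) : 3 ≤ S.card := by
  obtain ⟨a, ha, b, hb, c, hc, hab, hac, hbc, -⟩ := exists_triple_of_not_collinear h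
  exact Finset.two_lt_card.2 ⟨a, ha, b, hb, c, hc, hab, hac, hbc⟩

theorem plane_eq_of_not_collinear {H K : Finset (Fin m)} (hH : H ∈ f.planes) (hK : K ∈ f.planes)
    (hS : ¬ f.Collinear S) (hSH : S ⊆ H) (hSK : S ⊆ K) : H = K := by
  obtain ⟨a, ha, b, hb, c, hc, hab, hac, hbc, habc⟩ := exists_triple_of_not_collinear hS
  exact (f.existsUnique_plane a b c hab hac hbc habc).unique ⟨hH, hSH ha, hSH hb, hSH hc⟩
    ⟨hK, hSK ha, hSK hb, hSK hc⟩

theorem plane_eq_of_subset {H K : Finset (Fin m)} (hH : H ∈ f.planes) (hK : K ∈ f.planes)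
    (h : H ⊆ K) : H = K :=
  plane_eq_of_not_collinear hH hK (not_collinear_of_mem_planes hH) subset_rfl h

theorem mem_lines_iff_rank {L : Finset (Fin m)} : L ∈ f.lines ↔
    f.rank L = 2 ∧ ∀ x, f.rank (insert x L) = 2 → x ∈ L := by
  simp only [rank_eq_two_iff]
  constructor
  · intro hL
    refine ⟨⟨collinear_of_subset_line hL subset_rfl, f.two_le_card_line L hL⟩, fun x hx ↦ ?_⟩
    obtain ⟨a, ha, b, hb, hab⟩ := Finset.one_lt_card.1 (f.two_le_card_line L hL)
    rcases hx.1 with h | ⟨L', hL', h⟩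
    · lia
    · rw [line_eq_of_mem hL hL' hab ha hb (h (by simp [ha])) (h (by simp [hb]))]
      exact h (Finset.mem_insert_self x L)
  · rintro ⟨⟨h | ⟨L', hL', h⟩, hcard⟩, hclosed⟩
    · lia
    · have : L = L' := h.antisymm fun x hx ↦ hclosed x
        ⟨collinear_of_subset_line hL' (Finset.insert_subset hx h),
          hcard.trans (Finset.card_le_card (Finset.subset_insert x L))⟩
      rwa [this]

theorem mem_planes_iff_rank {H : Finset (Fin m)} : H ∈ f.planes ↔
    f.rank H = 3 ∧ ∀ x, f.rank (insert x H) = 3 → x ∈ H := by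
  simp only [rank_eq_three_iff]
  constructor
  · intro hH
    have hn := not_collinear_of_mem_planes hH
    refine ⟨⟨.inr ⟨H, hH, subset_rfl⟩, hn⟩, fun x hx ↦ ?_⟩
    obtain ⟨K, hK, h⟩ := hx.1.resolve_left hx.2
    rw [plane_eq_of_not_collinear hH hK hn subset_rfl ((Finset.subset_insert x H).trans h)]
    exact h (Finset.mem_insert_self x H)
  · rintro ⟨⟨hcop, hn⟩, hclosed⟩
    obtain ⟨K, hK, h⟩ := hcop.resolve_left hn
    have : H = K := h.antisymm fun x hx ↦ hclosed x
      ⟨.inr ⟨K, hK, Finset.insert_subset hx h⟩, fun hx ↦ hn (hx.subset (Finset.subset_insert x H))⟩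
    rwa [this]

theorem rank_injective : Function.Injective (rank : PlanarSpace m → Finset (Fin m) → ℕ) := by
  intro f g h
  ext S
  · rw [mem_lines_iff_rank, mem_lines_iff_rank, h]
  · rw [mem_planes_iff_rank, mem_planes_iff_rank, h]

theorem mem_withoutFullLines_iff :
    f ∈ withoutFullLines m ↔ ∀ S : Finset (Fin m), S.card = 3 → ¬ f.Collinear S := by
  simp only [withoutFullLines, Finset.mem_filter, Finset.mem_univ, true_and]
  constructor
  · rintro h S hS (hS' | ⟨L, hL, hSL⟩)
    · lia
    · have := Finset.card_le_card hSL
      have := h L hL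
      lia
  · intro h L hL
    by_contra! hcard
    obtain ⟨S, hSL, hS⟩ := Finset.exists_subset_card_eq hcard
    exact h S hS (collinear_of_subset_line hL hSL)

theorem injective_of_rank_image_eq {ρ : Fin m → Fin m}
    (hρ : ∀ S : Finset (Fin m), g.rank (S.image ρ) = f.rank S) : Function.Injective ρ := by
  intro a b hab
  by_contra hne
  have hle : f.rank {a, b} ≤ 1 := by
    rw [← hρ, rank_le_one_iff]
    simp [hab]
  exact absurd (two_le_rank (f := f) (Finset.card_pair hne).ge) (by lia)

theorem isomorphic_iff_exists_rank_image_eq : f.Isomorphic g ↔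
    ∃ ρ : Fin m → Fin m, ∀ S : Finset (Fin m), g.rank (S.image ρ) = f.rank S := by
  constructor
  · rintro ⟨ρ, hρ⟩
    refine ⟨ρ, fun S ↦ ?_⟩
    rw [← Equiv.coe_toEmbedding, ← Finset.map_eq_image, rank, Finset.card_map,
      Isomorphic.collinear (fun T ↦ (hρ T).1), Isomorphic.coplanar hρ, rank]
  · rintro ⟨ρ, hρ⟩
    let τ : Equiv.Perm (Fin m) :=
      .ofBijective ρ (Finite.injective_iff_bijective.1 (injective_of_rank_image_eq hρ))
    have hrank (S : Finset (Fin m)) : g.rank (S.map τ.toEmbedding) = f.rank S := by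
      rw [← hρ, Finset.map_eq_image]
      rfl
    have hinsert (x : Fin m) (S : Finset (Fin m)) :
        g.rank (insert (τ x) (S.map τ.toEmbedding)) = f.rank (insert x S) := by
      rw [← hrank, Finset.map_insert]
      rfl
    have hmem (x : Fin m) (S : Finset (Fin m)) : τ x ∈ S.map τ.toEmbedding ↔ x ∈ S :=
      Finset.mem_map' τ.toEmbedding
    refine ⟨τ, fun S ↦ ⟨?_, ?_⟩⟩
    · rw [mem_lines_iff_rank, mem_lines_iff_rank, ← τ.forall_congr_right]
      simp only [hrank, hinsert, hmem]
    · rw [mem_planes_iff_rank, mem_planes_iff_rank, ← τ.forall_congr_right]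
      simp only [hrank, hinsert, hmem]

end Rank

end PlanarSpace

namespace PlanarSpace

open scoped LinearAlgebra.Projectivization

section StrongRealization

variable {F : Type u} [Field F] {m : ℕ} {f g : PlanarSpace m} {σ : Fin m → P3 F}

/-- A dependency of a point `x` on a set `S` persists in every larger set. Planar spaces need not
have this property, but realizable ones do. -/
def IsClosureMonotone (f : PlanarSpace m) : Prop :=
  ∀ S T : Finset (Fin m), S ⊆ T → ∀ x, f.rank (insert x S) = f.rank S →
    f.rank (insert x T) = f.rank T

theorem isStrongRealization_iff_pointRank :
    f.IsStrongRealization σ ↔ ∀ S, pointRank σ S = f.rank S := by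
  have inLine_iff (S : Finset (Fin m)) : InLine (σ '' S) ↔ pointRank σ S ≤ 2 :=
    containedInFlat_image_iff (by norm_num)
  have inPlane_iff (S : Finset (Fin m)) : InPlane (σ '' S) ↔ pointRank σ S ≤ 3 :=
    containedInFlat_image_iff (by norm_num)
  constructor
  · intro h S
    have h2 := (inLine_iff S).symm.trans ((h.inLine_iff S).trans rank_le_two_iff.symm)
    have h3 := (inPlane_iff S).symm.trans ((h.inPlane_iff S).trans rank_le_three_iff.symm)
    rcases Nat.lt_or_ge 1 S.card with hS | hS
    · have := two_le_pointRank h.injective hS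
      have := two_le_rank (f := f) hS
      have : pointRank σ S ≤ 4 := pointRank_le_finrank.trans_eq (Module.finrank_fin_fun F)
      have := rank_le_four (f := f) (S := S)
      lia
    · rw [rank_of_card_le_one hS]
      rcases Nat.le_one_iff_eq_zero_or_eq_one.1 hS with hS | hS
      · rw [hS, Finset.card_eq_zero.1 hS, pointRank_empty]
      · obtain ⟨a, rfl⟩ := Finset.card_eq_one.1 hS
        exact pointRank_singleton a
  · intro h
    refine ⟨injective_of_two_le_pointRank fun S hS ↦ h S ▸ two_le_rank hS, fun S ↦ ?_, fun S ↦ ?_⟩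
    · rw [inLine_iff, h, rank_le_two_iff]
    · rw [inPlane_iff, h, rank_le_three_iff]

theorem IsStrongRealization.unique (hf : f.IsStrongRealization σ) (hg : g.IsStrongRealization σ) :
    f = g :=
  rank_injective <| funext fun S ↦
    (isStrongRealization_iff_pointRank.1 hf S).symm.trans (isStrongRealization_iff_pointRank.1 hg S)

theorem IsStrongRealization.isClosureMonotone (h : f.IsStrongRealization σ) :
    f.IsClosureMonotone := by
  rw [isStrongRealization_iff_pointRank] at h
  intro S T hST x hx
  rw [← h, ← h, ← submodule_le_pointSpan_iff] at hx ⊢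
  exact hx.trans (pointSpan_mono hST)

end StrongRealization

section OfPoints

variable {K V : Type*} [DivisionRing K] [AddCommGroup V] [Module K V] {m : ℕ} {σ : Fin m → ℙ K V}

theorem existsUnique_isPointFlat_pair {a b : Fin m} (hab : σ a ≠ σ b) :
    ∃! L, IsPointFlat σ 2 L ∧ a ∈ L ∧ b ∈ L := by
  have h := existsUnique_isPointFlat_superset σ {a, b}
  simpa only [pointRank_pair_eq_two_iff.2 hab, Finset.insert_subset_iff,
    Finset.singleton_subset_iff] using h

theorem existsUnique_isPointFlat_triple {a b c : Fin m} (hab : σ a ≠ σ b)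
    (habc : ¬ ∃ L, IsPointFlat σ 2 L ∧ a ∈ L ∧ b ∈ L ∧ c ∈ L) :
    ∃! H, IsPointFlat σ 3 H ∧ a ∈ H ∧ b ∈ H ∧ c ∈ H := by
  have h := existsUnique_isPointFlat_superset σ {a, b, c}
  simp only [Finset.insert_subset_iff, Finset.singleton_subset_iff] at h
  suffices hrank : pointRank σ {a, b, c} = 3 by rwa [hrank] at h
  have hge : 2 ≤ pointRank σ {a, b, c} :=
    (pointRank_pair_eq_two_iff.2 hab).ge.trans
      (pointRank_mono (by simp [Finset.insert_subset_iff]))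
  have hle : pointRank σ {a, b, c} ≤ 3 := pointRank_le_card.trans Finset.card_le_three
  have hne : pointRank σ {a, b, c} ≠ 2 := fun h2 ↦ habc (h2 ▸ h.exists)
  lia

open Classical in
/-- The planar space of a family of distinct points of a projective space: its lines and planes are
the traces of the lines and planes that are spanned by points of the family. -/
noncomputable def ofPoints (σ : Fin m → ℙ K V) (hσ : Function.Injective σ) : PlanarSpace m where
  lines := Finset.univ.filter (IsPointFlat σ 2)
  planes := Finset.univ.filter (IsPointFlat σ 3)
  two_le_card_line L hL := (Finset.mem_filter.1 hL).2.1.ge.trans pointRank_le_card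
  existsUnique_line a b hab := by
    simpa only [Finset.mem_filter_univ] using existsUnique_isPointFlat_pair (hσ.ne hab)
  existsUnique_plane a b c hab _ _ habc := by
    simp only [Finset.mem_filter_univ] at habc ⊢
    exact existsUnique_isPointFlat_triple (hσ.ne hab) habc
  plane_noncollinear H hH := by
    simp only [Finset.mem_filter_univ] at hH ⊢
    refine ⟨hH.1.ge.trans pointRank_le_card, fun L hL h ↦ ?_⟩
    have := pointRank_mono (σ := σ) h
    rw [hH.1, hL.1] at this
    lia

variable {S : Finset (Fin m)} {hσ : Function.Injective σ}

theorem mem_lines_ofPoints : S ∈ (ofPoints σ hσ).lines ↔ IsPointFlat σ 2 S := by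
  classical exact Finset.mem_filter_univ S

theorem mem_planes_ofPoints : S ∈ (ofPoints σ hσ).planes ↔ IsPointFlat σ 3 S := by
  classical exact Finset.mem_filter_univ S

theorem collinear_ofPoints_iff : (ofPoints σ hσ).Collinear S ↔ pointRank σ S ≤ 2 := by
  constructor
  · rintro (h | ⟨L, hL, h⟩)
    · exact pointRank_le_card.trans (h.trans one_le_two)
    · exact (pointRank_mono h).trans (mem_lines_ofPoints.1 hL).1.le
  · refine fun h ↦ or_iff_not_imp_left.2 fun hS ↦ ⟨pointClosure σ S, ?_, subset_pointClosure⟩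
    rw [mem_lines_ofPoints, ← h.antisymm (two_le_pointRank hσ (not_le.1 hS))]
    exact isPointFlat_pointClosure

theorem coplanar_ofPoints_iff : (ofPoints σ hσ).Coplanar S ↔ pointRank σ S ≤ 3 := by
  rw [Coplanar, collinear_ofPoints_iff]
  constructor
  · rintro (h | ⟨H, hH, h⟩)
    · exact h.trans (by norm_num)
    · exact (pointRank_mono h).trans (mem_planes_ofPoints.1 hH).1.le
  · refine fun h ↦ or_iff_not_imp_left.2 fun hS ↦ ⟨pointClosure σ S, ?_, subset_pointClosure⟩
    rw [mem_planes_ofPoints, ← h.antisymm (not_le.1 hS)]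
    exact isPointFlat_pointClosure

end OfPoints

section Counting

variable {F : Type u} [Field F] {m : ℕ}

theorem isStrongRealization_ofPoints {σ : Fin m → P3 F} (hσ : Function.Injective σ) :
    (ofPoints σ hσ).IsStrongRealization σ where
  injective := hσ
  inLine_iff _ := (containedInFlat_image_iff (by norm_num)).trans collinear_ofPoints_iff.symm
  inPlane_iff _ := (containedInFlat_image_iff (by norm_num)).trans coplanar_ofPoints_iff.symm

theorem sum_realizationCount [Finite F] (s : Finset (PlanarSpace m)) :
    ∑ f ∈ s, f.realizationCount F =
      Nat.card {σ : Fin m → P3 F // ∃ f ∈ s, f.IsStrongRealization σ} := by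
  classical
  have : Fintype (P3 F) := Fintype.ofFinite _
  simp only [realizationCount, Nat.card_eq_fintype_card, Fintype.card_subtype]
  rw [← Finset.card_biUnion]
  · congr 1
    ext σ
    simp
  · intro f _ g _ hfg
    simp only [Function.onFun, Finset.disjoint_left, Finset.mem_filter_univ]
    exact fun σ hf hg ↦ hfg (hf.unique hg)

theorem IsStrongRealization.isCap_range_iff {f : PlanarSpace m} {σ : Fin m → P3 F}
    (h : f.IsStrongRealization σ) : IsCap (Set.range σ) ↔ f ∈ withoutFullLines m := by
  have inLine_iff (a b c : Fin m) : InLine {σ a, σ b, σ c} ↔ f.Collinear {a, b, c} := by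
    simpa [Set.image_insert_eq] using h.inLine_iff {a, b, c}
  simp only [IsCap, Set.forall_mem_range, h.injective.ne_iff, inLine_iff, mem_withoutFullLines_iff,
    Finset.card_eq_three]
  grind

theorem capCount_eq_sum_realizationCount (n : ℕ) (F : Type u) [Field F] [Finite F] :
    capCount n F = ∑ f ∈ withoutFullLines n, f.realizationCount F := by
  rw [sum_realizationCount, capCount]
  refine Nat.card_congr (Equiv.subtypeEquivRight fun σ ↦ ?_)
  constructor
  · rintro ⟨hσ, hcap⟩
    have h := isStrongRealization_ofPoints hσ
    exact ⟨_, h.isCap_range_iff.1 hcap, h⟩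
  · rintro ⟨f, hf, h⟩
    exact ⟨h.injective, h.isCap_range_iff.2 hf⟩

end Counting

end PlanarSpace

namespace PlanarSpace

variable {m : ℕ} {f g : PlanarSpace m} {P Q : Fin m} {S T : Finset (Fin m)}

/-- The points of `S` other than `P` span a proper flat that contains `P`. -/
def SpansFlatThrough (f : PlanarSpace m) (P : Fin m) (S : Finset (Fin m)) : Prop :=
  P ∉ S ∧ f.rank (insert P S) = f.rank S ∧ f.rank S ≠ 4

/-- The locus of `P`, that is, the intersection of the flats through `P` spanned by other points,
is the intersection of at most two of these flats and, by the dimension formula, has vector space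
dimension `d` in every realization. -/
def HasLocusRank (f : PlanarSpace m) (P : Fin m) (d : ℕ) : Prop :=
  (d = 4 ∧ ∀ S, ¬ f.SpansFlatThrough P S) ∨
    ∃ A B, f.SpansFlatThrough P A ∧ f.SpansFlatThrough P B ∧
      (∀ S, f.SpansFlatThrough P S → f.rank (S ∪ A) = f.rank S ∨ f.rank (S ∪ B) = f.rank S) ∧
      d = f.rank A + f.rank B - f.rank (A ∪ B)

/-- The point `Q` lies on the locus of `P`. -/
def MemLocus (f : PlanarSpace m) (P Q : Fin m) : Prop :=
  Q ≠ P ∧ ∀ S, f.SpansFlatThrough P S → f.rank (insert Q S) = f.rank S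

/-- `g` arises from `f` by moving `P` within its locus to a possibly more special position. -/
def IsDegeneration (f : PlanarSpace m) (P : Fin m) (g : PlanarSpace m) : Prop :=
  (∀ S, P ∉ S → g.rank S = f.rank S) ∧
    (∀ S, f.SpansFlatThrough P S → g.rank (insert P S) = g.rank S) ∧ ∀ S, g.rank S ≤ f.rank S

/-- `g` is `f` with the point `P` deleted. -/
def IsDeletion (f : PlanarSpace (m + 1)) (P : Fin (m + 1)) (g : PlanarSpace m) : Prop :=
  ∀ S, g.rank S = f.rank (S.map P.succAboveEmb)

theorem isDegeneration_self : f.IsDegeneration P f :=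
  ⟨fun _ _ ↦ rfl, fun _ hS ↦ hS.2.1, fun _ ↦ le_rfl⟩

/-- The full lines through a point; their number is the line index. -/
def fullLines (f : PlanarSpace m) (P : Fin m) : Finset (Finset (Fin m)) :=
  f.lines.filter fun L ↦ P ∈ L ∧ 3 ≤ L.card

/-- The full planes through a point; their number is the plane index. -/
def fullPlanes (f : PlanarSpace m) (P : Fin m) : Finset (Finset (Fin m)) :=
  f.planes.filter fun H ↦ P ∈ H ∧ 4 ≤ H.card

theorem mem_fullLines {L : Finset (Fin m)} :
    L ∈ f.fullLines P ↔ L ∈ f.lines ∧ P ∈ L ∧ 3 ≤ L.card := Finset.mem_filter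

theorem mem_fullPlanes {H : Finset (Fin m)} :
    H ∈ f.fullPlanes P ↔ H ∈ f.planes ∧ P ∈ H ∧ 4 ≤ H.card := Finset.mem_filter

/-- `C` is a line or plane through `P` that is spanned by its points other than `P`. -/
def IsSpannedFlat (f : PlanarSpace m) (P : Fin m) (C : Finset (Fin m)) : Prop :=
  C ∈ f.fullLines P ∨ C ∈ f.fullPlanes P ∧ ¬ f.Collinear (C.erase P)

theorem IsSpannedFlat.spansFlatThrough_erase {C : Finset (Fin m)} (h : f.IsSpannedFlat P C) :
    f.SpansFlatThrough P (C.erase P) := by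
  suffices hr : P ∈ C ∧ f.rank C = f.rank (C.erase P) ∧ f.rank C ≠ 4 by
    obtain ⟨hP, hrank, h4⟩ := hr
    exact ⟨Finset.notMem_erase _ _, by rwa [Finset.insert_erase hP], hrank ▸ h4⟩
  rcases h with h | ⟨h, hn⟩
  · obtain ⟨hC, hP, hc⟩ := mem_fullLines.1 h
    have herase : f.rank (C.erase P) = 2 := rank_eq_two_iff.2
      ⟨collinear_of_subset_line hC (Finset.erase_subset _ _), by
        rw [Finset.card_erase_of_mem hP]; lia⟩
    rw [(mem_lines_iff_rank.1 hC).1, herase]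
    exact ⟨hP, rfl, by norm_num⟩
  · obtain ⟨hC, hP, -⟩ := mem_fullPlanes.1 h
    have herase : f.rank (C.erase P) = 3 :=
      rank_eq_three_iff.2 ⟨.inr ⟨C, hC, Finset.erase_subset _ _⟩, hn⟩
    rw [(mem_planes_iff_rank.1 hC).1, herase]
    exact ⟨hP, rfl, by norm_num⟩

theorem SpansFlatThrough.rank_eq (h : f.SpansFlatThrough P S) : f.rank S = 2 ∨ f.rank S = 3 := by
  obtain ⟨hP, hrank, h4⟩ := h
  have hcard : 1 < S.card := by
    by_contra hS
    rw [rank_of_card_le_one (not_lt.1 hS)] at hrank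
    have hS' : (insert P S).card ≤ 1 := rank_le_one_iff.1 (hrank.trans_le (not_lt.1 hS))
    rw [rank_of_card_le_one hS', Finset.card_insert_of_notMem hP] at hrank
    lia
  have := two_le_rank (f := f) hcard
  have := rank_le_four (f := f) (S := S)
  lia

theorem SpansFlatThrough.exists_isSpannedFlat (h : f.SpansFlatThrough P S) :
    ∃ C, f.IsSpannedFlat P C ∧ S ⊆ C ∧ f.rank C = f.rank S := by
  have hcard (C : Finset (Fin m)) (hSC : insert P S ⊆ C) : S.card + 1 ≤ C.card :=
    (Finset.card_insert_of_notMem h.1).symm.trans_le (Finset.card_le_card hSC)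
  rcases h.rank_eq with hS | hS
  · have hS2 := (rank_eq_two_iff.1 hS).2
    rcases (rank_eq_two_iff.1 (h.2.1.trans hS)).1 with hle | ⟨L, hL, hSL⟩
    · have := hcard _ subset_rfl
      lia
    · have := hcard L hSL
      refine ⟨L, .inl (mem_fullLines.2 ⟨hL, hSL (Finset.mem_insert_self _ _), by lia⟩),
        (Finset.subset_insert _ _).trans hSL, ?_⟩
      rw [hS, (mem_lines_iff_rank.1 hL).1]
  · have hn := (rank_eq_three_iff.1 hS).2
    obtain ⟨hcoll | ⟨H, hH, hSH⟩, hncoll⟩ := rank_eq_three_iff.1 (h.2.1.trans hS)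
    · exact absurd hcoll hncoll
    · have := hcard H hSH
      have := three_le_card_of_not_collinear hn
      have hSH' : S ⊆ H := (Finset.subset_insert _ _).trans hSH
      refine ⟨H, .inr ⟨mem_fullPlanes.2 ⟨hH, hSH (Finset.mem_insert_self _ _), by lia⟩,
        fun hc ↦ hn (hc.subset (Finset.subset_erase.2 ⟨hSH', h.1⟩))⟩, hSH', ?_⟩
      rw [hS, (mem_planes_iff_rank.1 hH).1]

theorem exists_hasLocusRank_of_card_le_two {𝓐 : Finset (Finset (Fin m))} (hcard : 𝓐.card ≤ 2)
    (h𝓐 : ∀ A ∈ 𝓐, f.IsSpannedFlat P A)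
    (hsub : ∀ C, f.IsSpannedFlat P C → ∃ A ∈ 𝓐, A ⊆ C) : ∃ d, f.HasLocusRank P d := by
  rcases 𝓐.eq_empty_or_nonempty with rfl | ⟨A, hA⟩
  · refine ⟨4, .inl ⟨rfl, fun S hS ↦ ?_⟩⟩
    obtain ⟨C, hC, -⟩ := hS.exists_isSpannedFlat
    simpa using hsub C hC
  · obtain ⟨B, hB, hAB⟩ : ∃ B ∈ 𝓐, ∀ C ∈ 𝓐, C = A ∨ C = B := by
      by_contra! hcon
      obtain ⟨B, hB, hBA, -⟩ := hcon A hA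
      obtain ⟨C, hC, hCA, hCB⟩ := hcon B hB
      have : 2 < 𝓐.card := Finset.two_lt_card.2 ⟨A, hA, B, hB, C, hC, hBA.symm, hCA.symm, hCB.symm⟩
      lia
    refine ⟨_, .inr ⟨A.erase P, B.erase P, (h𝓐 A hA).spansFlatThrough_erase,
      (h𝓐 B hB).spansFlatThrough_erase, fun S hS ↦ ?_, rfl⟩⟩
    obtain ⟨C, hC, hSC, hrank⟩ := hS.exists_isSpannedFlat
    have rank_union {D : Finset (Fin m)} (hD : D ⊆ C) : f.rank (S ∪ D.erase P) = f.rank S :=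
      le_antisymm
        (hrank ▸ rank_mono (Finset.union_subset hSC ((Finset.erase_subset _ _).trans hD)))
        (rank_mono Finset.subset_union_left)
    obtain ⟨D, hD, hDC⟩ := hsub C hC
    rcases hAB D hD with rfl | rfl
    exacts [.inl (rank_union hDC), .inr (rank_union hDC)]

theorem IsClosureMonotone.line_subset_plane (hf : f.IsClosureMonotone) {L H : Finset (Fin m)}
    (hL : L ∈ f.lines) (hH : H ∈ f.planes) {a b : Fin m} (hab : a ≠ b) (ha : a ∈ L) (hb : b ∈ L)
    (ha' : a ∈ H) (hb' : b ∈ H) : L ⊆ H := by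
  intro x hx
  have hpair : f.rank {a, b} = 2 := rank_eq_two_iff.2
    ⟨collinear_of_subset_line hL (by simp [Finset.insert_subset_iff, ha, hb]),
      (Finset.card_pair hab).ge⟩
  have htriple : f.rank (insert x {a, b}) = 2 := rank_eq_two_iff.2
    ⟨collinear_of_subset_line hL (by simp [Finset.insert_subset_iff, ha, hb, hx]),
      (Finset.card_pair hab).ge.trans (Finset.card_le_card (Finset.subset_insert _ _))⟩
  have hxH := hf {a, b} H (by simp [Finset.insert_subset_iff, ha', hb']) x (by rw [hpair, htriple])
  obtain ⟨hrank, hclosed⟩ := mem_planes_iff_rank.1 hH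
  exact hclosed x (hxH.trans hrank)

theorem not_collinear_insert {L : Finset (Fin m)} (hL : L ∈ f.lines) {R : Fin m} (hR : R ∉ L) :
    ¬ f.Collinear (insert R L) := fun h ↦
  hR <| (mem_lines_iff_rank.1 hL).2 R <| rank_eq_two_iff.2
    ⟨h, (f.two_le_card_line L hL).trans (Finset.card_le_card (Finset.subset_insert _ _))⟩

theorem IsClosureMonotone.exists_plane_superset (hf : f.IsClosureMonotone) {L : Finset (Fin m)}
    (hL : L ∈ f.lines) {R : Fin m} (hR : R ∉ L) : ∃ K ∈ f.planes, R ∈ K ∧ L ⊆ K := by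
  obtain ⟨a, ha, b, hb, hab⟩ := Finset.one_lt_card.1 (f.two_le_card_line L hL)
  obtain ⟨K, ⟨hK, ha', hb', hR'⟩, -⟩ := f.existsUnique_plane a b R hab (fun e ↦ hR (e ▸ ha))
    (fun e ↦ hR (e ▸ hb)) (by
      rintro ⟨L', hL', haL', hbL', hRL'⟩
      exact hR (line_eq_of_mem hL hL' hab ha hb haL' hbL' ▸ hRL'))
  exact ⟨K, hK, hR', hf.line_subset_plane hL hK hab ha hb ha' hb'⟩

theorem mem_fullPlanes_of_fullLine_subset {L K : Finset (Fin m)} (hL : L ∈ f.fullLines P)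
    (hK : K ∈ f.planes) (hLK : L ⊆ K) : K ∈ f.fullPlanes P := by
  obtain ⟨hL, hP, hc⟩ := mem_fullLines.1 hL
  have := Finset.card_lt_card ⟨hLK, (f.plane_noncollinear K hK).2 L hL⟩
  exact mem_fullPlanes.2 ⟨hK, hLK hP, by lia⟩

theorem IsClosureMonotone.exists_two_planes_superset (hf : f.IsClosureMonotone)
    {L H : Finset (Fin m)} (hL : L ∈ f.lines) (hH : H ∈ f.planes) (hLH : ¬ L ⊆ H) :
    ∃ K₁ ∈ f.planes, ∃ K₂ ∈ f.planes, K₁ ≠ K₂ ∧ L ⊆ K₁ ∧ L ⊆ K₂ := by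
  obtain ⟨R₁, -, hR₁⟩ := Finset.not_subset.1 ((f.plane_noncollinear H hH).2 L hL)
  obtain ⟨K₁, hK₁, -, hLK₁⟩ := hf.exists_plane_superset hL hR₁
  obtain ⟨R₂, -, hR₂⟩ := Finset.not_subset.1 fun h ↦ hLH (plane_eq_of_subset hH hK₁ h ▸ hLK₁)
  obtain ⟨K₂, hK₂, hR₂K₂, hLK₂⟩ := hf.exists_plane_superset hL fun h ↦ hR₂ (hLK₁ h)
  exact ⟨K₁, hK₁, K₂, hK₂, fun e ↦ hR₂ (e ▸ hR₂K₂), hLK₁, hLK₂⟩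

theorem exists_hasLocusRank_of_lineIndex_eq_zero (hL : f.lineIndex P = 0)
    (hH : f.planeIndex P ≤ 2) : ∃ d, f.HasLocusRank P d := by
  classical
  have hsub (C : Finset (Fin m)) (hC : f.IsSpannedFlat P C) : C ∈ f.fullPlanes P :=
    hC.elim (fun h ↦ absurd hL (Finset.card_ne_zero_of_mem h)) And.left
  refine exists_hasLocusRank_of_card_le_two (𝓐 := (f.fullPlanes P).filter (f.IsSpannedFlat P))
    ((Finset.card_filter_le _ _).trans hH) (fun A hA ↦ (Finset.mem_filter.1 hA).2) fun C hC ↦ ?_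
  exact ⟨C, Finset.mem_filter.2 ⟨hsub C hC, hC⟩, subset_rfl⟩

theorem IsClosureMonotone.exists_hasLocusRank_of_lineIndex_eq_one (hf : f.IsClosureMonotone)
    (hL : f.lineIndex P = 1) (hH : f.planeIndex P ≤ 3) : ∃ d, f.HasLocusRank P d := by
  obtain ⟨L, hL⟩ : ∃ L, f.fullLines P = {L} := Finset.card_eq_one.1 hL
  have hLP : L ∈ f.fullLines P := hL ▸ Finset.mem_singleton_self L
  have mem_fullPlanes_of_not_subset {C : Finset (Fin m)} (hC : f.IsSpannedFlat P C)
      (hLC : ¬ L ⊆ C) : C ∈ f.fullPlanes P :=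
    hC.elim (fun h ↦ absurd (Finset.mem_singleton.1 (hL ▸ h)).ge hLC) And.left
  by_cases hall : ∀ C, f.IsSpannedFlat P C → L ⊆ C
  · exact exists_hasLocusRank_of_card_le_two (𝓐 := {L}) (by simp)
      (by simpa using .inl hLP) (by simpa using hall)
  push Not at hall
  obtain ⟨H₁, hH₁, hLH₁⟩ := hall
  refine exists_hasLocusRank_of_card_le_two (𝓐 := {L, H₁}) Finset.card_le_two
    (by simpa using ⟨.inl hLP, hH₁⟩) fun H₂ hH₂ ↦ ?_
  by_contra! hcon
  obtain ⟨hLH₂, hH₁H₂⟩ : ¬ L ⊆ H₂ ∧ ¬ H₁ ⊆ H₂ := by simpa using hcon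
  have hH₁P := mem_fullPlanes_of_not_subset hH₁ hLH₁
  have hH₂P := mem_fullPlanes_of_not_subset hH₂ hLH₂
  obtain ⟨K₁, hK₁, K₂, hK₂, hK₁₂, hLK₁, hLK₂⟩ := hf.exists_two_planes_superset
    (mem_fullLines.1 hLP).1 (mem_fullPlanes.1 hH₁P).1 hLH₁
  have : 3 < f.planeIndex P := Finset.three_lt_card.2
    ⟨H₁, hH₁P, H₂, hH₂P, K₁, mem_fullPlanes_of_fullLine_subset hLP hK₁ hLK₁,
      K₂, mem_fullPlanes_of_fullLine_subset hLP hK₂ hLK₂, fun e ↦ hH₁H₂ e.le,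
      fun e ↦ hLH₁ (e ▸ hLK₁), fun e ↦ hLH₁ (e ▸ hLK₂), fun e ↦ hLH₂ (e ▸ hLK₁),
      fun e ↦ hLH₂ (e ▸ hLK₂), hK₁₂⟩
  lia

theorem IsClosureMonotone.exists_three_planes_superset (hf : f.IsClosureMonotone)
    {L₁ L₂ H : Finset (Fin m)} (hL₁ : L₁ ∈ f.lines) (hL₂ : L₂ ∈ f.lines) (h12 : L₁ ≠ L₂)
    (hP₁ : P ∈ L₁) (hP₂ : P ∈ L₂) (hH : H ∈ f.planes) (hL₁H : ¬ L₁ ⊆ H) :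
    ∃ K ∈ f.planes, ∃ K₁ ∈ f.planes, ∃ K₂ ∈ f.planes, K ≠ K₁ ∧ K ≠ K₂ ∧ K₁ ≠ K₂ ∧
      L₁ ⊆ K ∧ L₁ ⊆ K₁ ∧ L₂ ⊆ K₂ := by
  obtain ⟨b, hb, hbP⟩ : ∃ b ∈ L₂, b ≠ P := Finset.exists_mem_ne (f.two_le_card_line L₂ hL₂) P
  have hbL₁ : b ∉ L₁ := fun h ↦ h12 (line_eq_of_mem hL₁ hL₂ hbP h hP₁ hb hP₂)
  obtain ⟨K, hK, hbK, hL₁K⟩ := hf.exists_plane_superset hL₁ hbL₁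
  have hL₂K : L₂ ⊆ K := hf.line_subset_plane hL₂ hK hbP hb hP₂ hbK (hL₁K hP₁)
  obtain ⟨R, -, hRK⟩ := Finset.not_subset.1 fun h ↦ hL₁H (plane_eq_of_subset hH hK h ▸ hL₁K)
  obtain ⟨K₁, hK₁, hRK₁, hLK₁⟩ := hf.exists_plane_superset hL₁ fun h ↦ hRK (hL₁K h)
  obtain ⟨K₂, hK₂, hRK₂, hLK₂⟩ := hf.exists_plane_superset hL₂ fun h ↦ hRK (hL₂K h)
  refine ⟨K, hK, K₁, hK₁, K₂, hK₂, fun e ↦ hRK (e ▸ hRK₁), fun e ↦ hRK (e ▸ hRK₂), fun e ↦ ?_,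
    hL₁K, hLK₁, hLK₂⟩
  have hK₁K : K₁ = K := plane_eq_of_not_collinear hK₁ hK (not_collinear_insert hL₁ hbL₁)
    (Finset.insert_subset (e ▸ hLK₂ hb) hLK₁) (Finset.insert_subset hbK hL₁K)
  exact hRK (hK₁K ▸ hRK₁)

theorem IsClosureMonotone.exists_hasLocusRank_of_lineIndex_eq_two (hf : f.IsClosureMonotone)
    (hL : f.lineIndex P = 2) (hH : f.planeIndex P ≤ 3) : ∃ d, f.HasLocusRank P d := by
  obtain ⟨L₁, L₂, h12, hL₁₂⟩ : ∃ L₁ L₂, L₁ ≠ L₂ ∧ f.fullLines P = {L₁, L₂} :=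
    Finset.card_eq_two.1 hL
  have hL₁ : L₁ ∈ f.fullLines P := hL₁₂ ▸ Finset.mem_insert_self _ _
  have hL₂ : L₂ ∈ f.fullLines P := hL₁₂ ▸ Finset.mem_insert_of_mem (Finset.mem_singleton_self _)
  refine exists_hasLocusRank_of_card_le_two hL.le (fun _ ↦ .inl) fun H hH' ↦ ?_
  by_contra! hcon
  have hHP : H ∈ f.fullPlanes P := hH'.elim (fun h ↦ absurd subset_rfl (hcon H h)) And.left
  obtain ⟨hL₁', hP₁, -⟩ := mem_fullLines.1 hL₁
  obtain ⟨hL₂', hP₂, -⟩ := mem_fullLines.1 hL₂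
  obtain ⟨K, hK, K₁, hK₁, K₂, hK₂, h1, h2, h3, hLK, hLK₁, hLK₂⟩ :=
    hf.exists_three_planes_superset hL₁' hL₂' h12 hP₁ hP₂ (mem_fullPlanes.1 hHP).1 (hcon L₁ hL₁)
  have : 3 < f.planeIndex P := Finset.three_lt_card.2
    ⟨H, hHP, K, mem_fullPlanes_of_fullLine_subset hL₁ hK hLK,
      K₁, mem_fullPlanes_of_fullLine_subset hL₁ hK₁ hLK₁,
      K₂, mem_fullPlanes_of_fullLine_subset hL₂ hK₂ hLK₂, fun e ↦ hcon L₁ hL₁ (e ▸ hLK),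
      fun e ↦ hcon L₁ hL₁ (e ▸ hLK₁), fun e ↦ hcon L₂ hL₂ (e ▸ hLK₂), h1, h2, h3⟩
  lia

theorem IsClosureMonotone.exists_hasLocusRank (hf : f.IsClosureMonotone)
    (hP : ¬ (4 ≤ f.planeIndex P ∨ 3 ≤ f.lineIndex P ∨ (f.planeIndex P = 3 ∧ f.lineIndex P = 0))) :
    ∃ d, f.HasLocusRank P d := by
  obtain h0 | h1 | h2 : f.lineIndex P = 0 ∨ f.lineIndex P = 1 ∨ f.lineIndex P = 2 := by lia
  · exact exists_hasLocusRank_of_lineIndex_eq_zero h0 (by lia)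
  · exact hf.exists_hasLocusRank_of_lineIndex_eq_one h1 (by lia)
  · exact hf.exists_hasLocusRank_of_lineIndex_eq_two h2 (by lia)

end PlanarSpace

section InsertNth

theorem exists_eq_map_succAbove {m : ℕ} {P : Fin (m + 1)} {S : Finset (Fin (m + 1))} (h : P ∉ S) :
    ∃ T : Finset (Fin m), S = T.map P.succAboveEmb := by
  have hS : S ⊆ Finset.univ.map P.succAboveEmb := fun x hx ↦ by
    simpa using Fin.exists_succAbove_eq fun e : x = P ↦ h (e ▸ hx)
  obtain ⟨T, -, hT⟩ := Finset.subset_map_iff.1 hS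
  exact ⟨T, hT⟩

theorem notMem_map_succAbove {m : ℕ} {P : Fin (m + 1)} {T : Finset (Fin m)} :
    P ∉ T.map P.succAboveEmb := by
  simp [Fin.succAbove_ne]

theorem injective_of_injective_removeNth {α : Type*} {m : ℕ} {P : Fin (m + 1)}
    {σ : Fin (m + 1) → α} (hσ : Function.Injective (P.removeNth σ))
    (hP : σ P ∉ Set.range (P.removeNth σ)) : Function.Injective σ := by
  have hne (i : Fin m) : σ (P.succAbove i) ≠ σ P := fun h ↦ hP ⟨i, h⟩
  have hinj (i j : Fin m) : σ (P.succAbove i) = σ (P.succAbove j) → i = j := @hσ i j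
  simp only [Function.Injective, Fin.forall_iff_succAbove P]
  exact ⟨⟨fun _ ↦ trivial, fun i h ↦ absurd h.symm (hne i)⟩,
    fun i ↦ ⟨fun h ↦ absurd h (hne i), fun j h ↦ congrArg _ (hinj i j h)⟩⟩

end InsertNth

theorem card_subtype_prod_add {α β : Type*} [Finite α] [Finite β] {p : α → Prop}
    {r : α → β → Prop} {k c : ℕ} (h : ∀ a, p a → Nat.card {b // r a b} + k = c) :
    Nat.card {x : β × α // p x.2 ∧ r x.2 x.1} + k * Nat.card {a // p a} =
      c * Nat.card {a // p a} := by
  let fiberEquiv : {x : β × α // p x.2 ∧ r x.2 x.1} ≃ (Σ a : {a // p a}, {b // r a b}) :=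
    { toFun x := ⟨⟨x.1.2, x.2.1⟩, x.1.1, x.2.2⟩
      invFun y := ⟨(y.2, y.1), y.1.2, y.2.2⟩ }
  have := Fintype.ofFinite {a // p a}
  calc Nat.card {x : β × α // p x.2 ∧ r x.2 x.1} + k * Nat.card {a // p a}
    _ = ∑ a : {a // p a}, (Nat.card {b // r a b} + k) := by
      rw [Nat.card_congr fiberEquiv, Nat.card_sigma, Finset.sum_add_distrib, Finset.sum_const,
        Finset.card_univ, Nat.card_eq_fintype_card, smul_eq_mul, mul_comm k]
    _ = c * Nat.card {a // p a} := by
      rw [Finset.sum_congr rfl fun (a : {a // p a}) _ ↦ h a a.2, Finset.sum_const, Finset.card_univ,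
        Nat.card_eq_fintype_card, smul_eq_mul, mul_comm]

namespace PlanarSpace

open scoped LinearAlgebra.Projectivization

variable {F : Type u} [Field F] {m : ℕ} {f : PlanarSpace (m + 1)} {P : Fin (m + 1)} {d : ℕ}

section Locus

/-- The intersection of the flats through `P` that are spanned by other points, for given
positions `σ` of the other points. -/
noncomputable def locus (f : PlanarSpace (m + 1)) (P : Fin (m + 1)) (σ : Fin m → P3 F) :
    Submodule F (Fin 4 → F) :=
  ⨅ S : {S : Finset (Fin m) // f.SpansFlatThrough P (S.map P.succAboveEmb)}, pointSpan σ S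

/-- The tuple `σ` is a strong realization of `f` with `P` deleted. -/
def RealizesDeletion (f : PlanarSpace (m + 1)) (P : Fin (m + 1)) (σ : Fin m → P3 F) : Prop :=
  ∀ S, pointRank σ S = f.rank (S.map P.succAboveEmb)

variable {σ : Fin m → P3 F}

theorem le_locus_iff {W : Submodule F (Fin 4 → F)} : W ≤ f.locus P σ ↔
    ∀ S : Finset (Fin m), f.SpansFlatThrough P (S.map P.succAboveEmb) → W ≤ pointSpan σ S := by
  rw [locus, le_iInf_iff, Subtype.forall]

theorem RealizesDeletion.injective (hσ : f.RealizesDeletion P σ) : Function.Injective σ :=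
  injective_of_two_le_pointRank fun S hS ↦ (two_le_rank (by rwa [Finset.card_map])).trans (hσ S).ge

theorem realizesDeletion_iff_exists :
    f.RealizesDeletion P σ ↔ ∃ g, f.IsDeletion P g ∧ g.IsStrongRealization σ := by
  constructor
  · intro h
    have hg := isStrongRealization_ofPoints h.injective
    exact ⟨_, fun S ↦ (isStrongRealization_iff_pointRank.1 hg S).symm.trans (h S), hg⟩
  · rintro ⟨g, hg, h⟩ S
    exact (isStrongRealization_iff_pointRank.1 h S).trans (hg S)

theorem RealizesDeletion.pointSpan_le (hσ : f.RealizesDeletion P σ) {S T : Finset (Fin m)}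
    (h : f.rank (S.map P.succAboveEmb ∪ T.map P.succAboveEmb) = f.rank (S.map P.succAboveEmb)) :
    pointSpan σ T ≤ pointSpan σ S := by
  rw [← Finset.map_union, ← hσ, ← hσ] at h
  rw [pointSpan_eq_of_pointRank_le Finset.subset_union_left h.le]
  exact pointSpan_mono Finset.subset_union_right

theorem RealizesDeletion.finrank_locus (hσ : f.RealizesDeletion P σ) (h : f.HasLocusRank P d) :
    Module.finrank F (f.locus P σ) = d := by
  rcases h with ⟨rfl, h⟩ | ⟨A, B, hA, hB, h, rfl⟩
  · have : f.locus P σ = ⊤ := top_le_iff.1 (le_locus_iff.2 fun S hS ↦ absurd hS (h _))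
    rw [this, finrank_top, Module.finrank_fin_fun]
  · obtain ⟨A, rfl⟩ := exists_eq_map_succAbove hA.1
    obtain ⟨B, rfl⟩ := exists_eq_map_succAbove hB.1
    have hlocus : f.locus P σ = pointSpan σ A ⊓ pointSpan σ B := by
      refine le_antisymm (le_inf (le_locus_iff.1 le_rfl A hA) (le_locus_iff.1 le_rfl B hB))
        (le_locus_iff.2 fun S hS ↦ ?_)
      rcases h _ hS with h | h
      · exact inf_le_left.trans (hσ.pointSpan_le h)
      · exact inf_le_right.trans (hσ.pointSpan_le h)
    have hdim := Submodule.finrank_sup_add_finrank_inf_eq (pointSpan σ A) (pointSpan σ B)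
    rw [← pointSpan_union, ← pointRank, ← pointRank, ← pointRank, hσ, hσ, hσ,
      Finset.map_union] at hdim
    rw [hlocus]
    lia

theorem RealizesDeletion.submodule_le_locus_iff (hσ : f.RealizesDeletion P σ) {i : Fin m} :
    (σ i).submodule ≤ f.locus P σ ↔ f.MemLocus P (P.succAbove i) := by
  have hmem (S : Finset (Fin m)) : (σ i).submodule ≤ pointSpan σ S ↔
      f.rank (insert (P.succAbove i) (S.map P.succAboveEmb)) = f.rank (S.map P.succAboveEmb) := by
    rw [submodule_le_pointSpan_iff, hσ, hσ, Finset.map_insert, Fin.coe_succAboveEmb]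
  simp only [le_locus_iff, hmem]
  constructor
  · refine fun h ↦ ⟨Fin.succAbove_ne _ _, fun S hS ↦ ?_⟩
    obtain ⟨S, rfl⟩ := exists_eq_map_succAbove hS.1
    exact h S hS
  · exact fun h S hS ↦ h.2 _ hS

open Classical in
theorem RealizesDeletion.card_submodule_le_locus_add (hσ : f.RealizesDeletion P σ) [Finite F]
    (h : f.HasLocusRank P d) :
    Nat.card {x // x.submodule ≤ f.locus P σ ∧ x ∉ Set.range σ} +
        (Finset.univ.filter (f.MemLocus P)).card =
      ∑ i ∈ Finset.range d, Nat.card F ^ i := by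
  have := Fintype.ofFinite (P3 F)
  have hocc : Finset.univ.filter (f.MemLocus P) =
      (Finset.univ.filter fun i ↦ (σ i).submodule ≤ f.locus P σ).map P.succAboveEmb := by
    ext Q
    simp only [Finset.mem_map, Finset.mem_filter_univ, hσ.submodule_le_locus_iff,
      Fin.coe_succAboveEmb]
    refine ⟨fun hQ ↦ ?_, fun ⟨_, hi, hQ⟩ ↦ hQ ▸ hi⟩
    obtain ⟨i, rfl⟩ := Fin.exists_succAbove_eq hQ.1
    exact ⟨i, hQ, rfl⟩
  have hrange : (Finset.univ.filter fun i ↦ (σ i).submodule ≤ f.locus P σ).image σ =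
      Finset.univ.filter fun x ↦ x.submodule ≤ f.locus P σ ∧ x ∈ Set.range σ := by
    ext x
    simp only [Finset.mem_image, Finset.mem_filter_univ, Set.mem_range]
    grind
  rw [← hσ.finrank_locus h, ← card_submodule_le, hocc, Finset.card_map,
    ← Finset.card_image_of_injective _ hσ.injective, hrange, Nat.card_eq_fintype_card,
    Nat.card_eq_fintype_card, Fintype.card_subtype, Fintype.card_subtype, add_comm,
    ← Finset.filter_filter, ← Finset.filter_filter, Finset.card_filter_add_card_filter_not]

end Locus

section Degeneration

variable {g : PlanarSpace (m + 1)} {σ : Fin (m + 1) → P3 F}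

theorem isDegeneration_of_rank_insert_le (hdel : ∀ S, P ∉ S → g.rank S = f.rank S)
    (hspan : ∀ S, f.SpansFlatThrough P S → g.rank (insert P S) = g.rank S)
    (hinsert : ∀ S, g.rank (insert P S) ≤ g.rank S + 1) : f.IsDegeneration P g := by
  refine ⟨hdel, hspan, fun S ↦ ?_⟩
  by_cases hP : P ∈ S
  · obtain ⟨T, hT, rfl⟩ : ∃ T, P ∉ T ∧ insert P T = S :=
      ⟨S.erase P, Finset.notMem_erase _ _, Finset.insert_erase hP⟩
    have hmono := rank_mono (f := f) (Finset.subset_insert P T)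
    by_cases htop : f.rank T = 4
    · exact rank_le_four.trans (htop.ge.trans hmono)
    by_cases hdep : f.rank (insert P T) = f.rank T
    · rw [hspan T ⟨hT, hdep, htop⟩, hdel T hT, hdep]
    · have := hinsert T
      rw [hdel T hT] at this
      lia
  · exact (hdel S hP).le

theorem IsDegeneration.realizesDeletion (hg : f.IsDegeneration P g)
    (h : g.IsStrongRealization σ) : f.RealizesDeletion P (P.removeNth σ) := fun S ↦ by
  rw [← hg.1 _ notMem_map_succAbove, ← isStrongRealization_iff_pointRank.1 h, pointRank_map]
  rfl

theorem IsDegeneration.submodule_le_locus (hg : f.IsDegeneration P g)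
    (h : g.IsStrongRealization σ) : (σ P).submodule ≤ f.locus P (P.removeNth σ) := by
  refine le_locus_iff.2 fun S hS ↦ ?_
  have hrank := hg.2.1 _ hS
  rw [← isStrongRealization_iff_pointRank.1 h, ← isStrongRealization_iff_pointRank.1 h,
    ← submodule_le_pointSpan_iff, pointSpan_map] at hrank
  exact hrank

theorem RealizesDeletion.exists_isDegeneration (hdel : f.RealizesDeletion P (P.removeNth σ))
    (hlocus : (σ P).submodule ≤ f.locus P (P.removeNth σ))
    (hP : σ P ∉ Set.range (P.removeNth σ)) :
    ∃ g, f.IsDegeneration P g ∧ g.IsStrongRealization σ := by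
  have hg := isStrongRealization_ofPoints (injective_of_injective_removeNth hdel.injective hP)
  have hrank := isStrongRealization_iff_pointRank.1 hg
  refine ⟨_, isDegeneration_of_rank_insert_le (fun S hS ↦ ?_) (fun S hS ↦ ?_) fun S ↦ ?_, hg⟩
  · obtain ⟨S, rfl⟩ := exists_eq_map_succAbove hS
    exact (hrank _).symm.trans ((pointRank_map _ S).trans (hdel S))
  · obtain ⟨S, rfl⟩ := exists_eq_map_succAbove hS.1
    rw [← hrank, ← hrank, ← submodule_le_pointSpan_iff, pointSpan_map]
    exact le_locus_iff.1 hlocus S hS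
  · rw [← hrank, ← hrank]
    exact pointRank_insert_le P

theorem exists_isDegeneration_iff : (∃ g, f.IsDegeneration P g ∧ g.IsStrongRealization σ) ↔
    f.RealizesDeletion P (P.removeNth σ) ∧
      (σ P).submodule ≤ f.locus P (P.removeNth σ) ∧ σ P ∉ Set.range (P.removeNth σ) := by
  refine ⟨fun ⟨g, hg, h⟩ ↦ ⟨hg.realizesDeletion h, hg.submodule_le_locus h, ?_⟩,
    fun ⟨hdel, hlocus, hP⟩ ↦ hdel.exists_isDegeneration hlocus hP⟩
  exact fun ⟨i, hi⟩ ↦ Fin.succAbove_ne P i (h.injective hi)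

open Classical in
theorem HasLocusRank.sum_realizationCount_isDegeneration [Finite F] (h : f.HasLocusRank P d) :
    ∑ g ∈ Finset.univ.filter (f.IsDegeneration P), g.realizationCount F +
      (Finset.univ.filter (f.MemLocus P)).card *
        ∑ g ∈ Finset.univ.filter (f.IsDeletion P), g.realizationCount F =
    (∑ i ∈ Finset.range d, Nat.card F ^ i) *
      ∑ g ∈ Finset.univ.filter (f.IsDeletion P), g.realizationCount F := by
  let removeEquiv : (Fin (m + 1) → P3 F) ≃ P3 F × (Fin m → P3 F) :=
    (Fin.insertNthEquiv (fun _ ↦ P3 F) P).symm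
  have hext : Nat.card {σ : Fin (m + 1) → P3 F // ∃ g, f.IsDegeneration P g ∧
      g.IsStrongRealization σ} = Nat.card {x : P3 F × (Fin m → P3 F) // f.RealizesDeletion P x.2 ∧
        x.1.submodule ≤ f.locus P x.2 ∧ x.1 ∉ Set.range x.2} :=
    Nat.card_congr (removeEquiv.subtypeEquiv fun _ ↦ exists_isDegeneration_iff)
  simp only [sum_realizationCount, Finset.mem_filter_univ, ← realizesDeletion_iff_exists, hext]
  have hfiber (σ : Fin m → P3 F) (hσ : f.RealizesDeletion P σ) :=
    hσ.card_submodule_le_locus_add h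
  exact card_subtype_prod_add hfiber

end Degeneration

end PlanarSpace

section Primrec

attribute [fun_prop] Primrec PrimrecPred Primrec.id Primrec.const Primrec.comp Primrec.pair
  PrimrecPred.not PrimrecPred.and PrimrecPred.or

variable {α β γ : Type*} [Primcodable α] [Primcodable β] [Primcodable γ]

@[fun_prop]
theorem primrec_fst {f : α → β × γ} (hf : Primrec f) : Primrec fun a ↦ (f a).1 :=
  Primrec.fst.comp hf

@[fun_prop]
theorem primrec_snd {f : α → β × γ} (hf : Primrec f) : Primrec fun a ↦ (f a).2 :=
  Primrec.snd.comp hf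

@[fun_prop]
theorem primrec_cons {f : α → β} {g : α → List β} (hf : Primrec f) (hg : Primrec g) :
    Primrec fun a ↦ f a :: g a := Primrec.list_cons.comp hf hg

@[fun_prop]
theorem primrec_append {f g : α → List β} (hf : Primrec f) (hg : Primrec g) :
    Primrec fun a ↦ f a ++ g a := Primrec.list_append.comp hf hg

@[fun_prop]
theorem primrec_length {f : α → List β} (hf : Primrec f) : Primrec fun a ↦ (f a).length :=
  Primrec.list_length.comp hf

@[fun_prop]
theorem primrec_range {f : α → ℕ} (hf : Primrec f) : Primrec fun a ↦ List.range (f a) :=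
  Primrec.list_range.comp hf

@[fun_prop]
theorem primrec_headI [Inhabited β] {f : α → List β} (hf : Primrec f) :
    Primrec fun a ↦ (f a).headI := Primrec.list_headI.comp hf

@[fun_prop]
theorem primrec_getD {f : α → List β} {g : α → ℕ} (d : β) (hf : Primrec f) (hg : Primrec g) :
    Primrec fun a ↦ (f a).getD (g a) d := (Primrec.list_getD d).comp hf hg

@[fun_prop]
theorem primrec_add {f g : α → ℕ} (hf : Primrec f) (hg : Primrec g) :
    Primrec fun a ↦ f a + g a := Primrec.nat_add.comp hf hg

@[fun_prop]
theorem primrec_sub {f g : α → ℕ} (hf : Primrec f) (hg : Primrec g) :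
    Primrec fun a ↦ f a - g a := Primrec.nat_sub.comp hf hg

@[fun_prop]
theorem primrec_mul {f g : α → ℕ} (hf : Primrec f) (hg : Primrec g) :
    Primrec fun a ↦ f a * g a := Primrec.nat_mul.comp hf hg

@[fun_prop]
theorem primrec_mod {f g : α → ℕ} (hf : Primrec f) (hg : Primrec g) :
    Primrec fun a ↦ f a % g a := Primrec.nat_mod.comp hf hg

@[fun_prop]
theorem primrecPred_eq {f g : α → β} (hf : Primrec f) (hg : Primrec g) :
    PrimrecPred fun a ↦ f a = g a := Primrec.eq.comp hf hg

@[fun_prop]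
theorem primrecPred_le {f g : α → ℕ} (hf : Primrec f) (hg : Primrec g) :
    PrimrecPred fun a ↦ f a ≤ g a := Primrec.nat_le.comp hf hg

@[fun_prop]
theorem primrecPred_lt {f g : α → ℕ} (hf : Primrec f) (hg : Primrec g) :
    PrimrecPred fun a ↦ f a < g a := Primrec.nat_lt.comp hf hg

@[fun_prop]
theorem primrecPred_mem {f : α → β} {g : α → List β} (hf : Primrec f) (hg : Primrec g) :
    PrimrecPred fun a ↦ f a ∈ g a :=
  ((PrimrecRel.exists_mem_list Primrec.eq).comp hg hf).of_eq fun a ↦ by simp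

@[fun_prop]
theorem primrecPred_imp {p q : α → Prop} (hp : PrimrecPred p) (hq : PrimrecPred q) :
    PrimrecPred fun a ↦ p a → q a := (hp.not.or hq).of_eq fun _ ↦ imp_iff_not_or.symm

@[fun_prop]
theorem primrecPred_ball {l : α → List β} {p : α → β → Prop} (hl : Primrec l)
    (hp : PrimrecPred fun x : α × β ↦ p x.1 x.2) : PrimrecPred fun a ↦ ∀ x ∈ l a, p a x :=
  (PrimrecRel.forall_mem_list (R := fun x a ↦ p a x) (hp.comp (Primrec.pair .snd .fst))).comp hl .id

@[fun_prop]
theorem primrecPred_bex {l : α → List β} {p : α → β → Prop} (hl : Primrec l)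
    (hp : PrimrecPred fun x : α × β ↦ p x.1 x.2) : PrimrecPred fun a ↦ ∃ x ∈ l a, p a x :=
  (PrimrecRel.exists_mem_list (R := fun x a ↦ p a x) (hp.comp (Primrec.pair .snd .fst))).comp hl .id

@[fun_prop]
theorem primrec_ite {p : α → Prop} {_ : ∀ a, Decidable (p a)} {f g : α → β}
    (hp : PrimrecPred p) (hf : Primrec f) (hg : Primrec g) :
    Primrec fun a ↦ if p a then f a else g a := Primrec.ite hp hf hg

@[fun_prop]
theorem primrec_map {l : α → List β} {f : α → β → γ} (hl : Primrec l)
    (hf : Primrec fun x : α × β ↦ f x.1 x.2) : Primrec fun a ↦ (l a).map (f a) :=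
  Primrec.list_map hl hf

@[fun_prop]
theorem primrec_flatMap {l : α → List β} {f : α → β → List γ} (hl : Primrec l)
    (hf : Primrec fun x : α × β ↦ f x.1 x.2) : Primrec fun a ↦ (l a).flatMap (f a) :=
  Primrec.list_flatMap hl hf

@[fun_prop]
theorem primrec_filter {l : α → List β} {p : α → β → Prop} {_ : ∀ a b, Decidable (p a b)}
    (hl : Primrec l) (hp : PrimrecPred fun x : α × β ↦ p x.1 x.2) :
    Primrec fun a ↦ (l a).filter fun x ↦ p a x :=
  (PrimrecRel.listFilter (R := fun x a ↦ p a x) (hp.comp (Primrec.pair .snd .fst))).comp hl .id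

@[fun_prop]
theorem primrec_sublists {l : α → List β} (hl : Primrec l) : Primrec fun a ↦ (l a).sublists :=
  Primrec.list_foldr
    (h := fun _ (x : β × List (List β)) ↦ x.2.flatMap fun y ↦ [y, x.1 :: y]) hl (by fun_prop)
    (.mk (by fun_prop))

@[fun_prop]
theorem primrec_sum {l : α → List ℕ} (hl : Primrec l) : Primrec fun a ↦ (l a).sum :=
  Primrec.list_foldr (h := fun _ (x : ℕ × ℕ) ↦ x.1 + x.2) hl (.const 0) (.mk (by fun_prop))

theorem encode_natCast_sub (m n : ℕ) : Encodable.encode ((m : ℤ) - n) =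
    if n ≤ m then 2 * (m - n) else 2 * (n - m - 1) + 1 := by
  split_ifs with h
  · rw [← Nat.cast_sub h]
    rfl
  · have : (m : ℤ) - n = Int.negSucc (n - m - 1) := by lia
    rw [this]
    rfl

@[fun_prop]
theorem primrec_natCast_sub {f g : α → ℕ} (hf : Primrec f) (hg : Primrec g) :
    Primrec fun a ↦ (f a : ℤ) - g a := by
  rw [← Primrec.encode_iff]
  simp only [encode_natCast_sub]
  fun_prop

end Primrec

/-- Codes of planar spaces, as produced by `PlanarSpace.code`. -/
abbrev SpaceCode : Type := ℕ × List (List ℕ) × List (List ℕ)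

/-- A triple `(s, e, c)` that stands for `(-1) ^ s * q ^ e` times the number of strong realizations
of the planar space with code `c`. -/
abbrev WeightedCode : Type := ℕ × ℕ × SpaceCode

namespace SpaceCode

/-- The subsets of `{0, …, m - 1}`, as increasing lists. -/
def subsets (m : ℕ) : List (List ℕ) := (List.range m).sublists

/-- The families of subsets of `{0, …, m - 1}`. -/
def families (m : ℕ) : List (List (List ℕ)) := (subsets m).sublists

/-- The lists of length `k` with entries less than `m`. -/
def tuples (m k : ℕ) : List (List ℕ) :=
  (fun ls ↦ ls.flatMap fun l ↦ (List.range m).map fun x ↦ x :: l)^[k] [[]]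

open Classical in
/-- The rank of a list of points, see `PlanarSpace.rank`. -/
noncomputable def rank (c : SpaceCode) (l : List ℕ) : ℕ :=
  if l = [] then 0
  else if ∀ x ∈ l, ∀ y ∈ l, x = y then 1
  else if ∃ L ∈ c.2.1, ∀ x ∈ l, x ∈ L then 2
  else if ∃ H ∈ c.2.2, ∀ x ∈ l, x ∈ H then 3
  else 4

/-- The axioms of planar spaces. -/
def IsPlanar (c : SpaceCode) : Prop :=
  (∀ L ∈ c.2.1, 2 ≤ L.length) ∧
    (∀ x ∈ List.range c.1, ∀ y ∈ List.range c.1, x ≠ y →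
      ∃ L ∈ c.2.1, (x ∈ L ∧ y ∈ L) ∧ ∀ L' ∈ c.2.1, x ∈ L' ∧ y ∈ L' → L' = L) ∧
    (∀ x ∈ List.range c.1, ∀ y ∈ List.range c.1, ∀ z ∈ List.range c.1, x ≠ y → x ≠ z → y ≠ z →
      (¬ ∃ L ∈ c.2.1, x ∈ L ∧ y ∈ L ∧ z ∈ L) →
      ∃ H ∈ c.2.2, (x ∈ H ∧ y ∈ H ∧ z ∈ H) ∧
        ∀ H' ∈ c.2.2, x ∈ H' ∧ y ∈ H' ∧ z ∈ H' → H' = H) ∧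
    ∀ H ∈ c.2.2, 3 ≤ H.length ∧ ∀ L ∈ c.2.1, ¬ ∀ x ∈ H, x ∈ L

open Classical in
/-- The codes of the planar spaces on `m` points. -/
noncomputable def all (m : ℕ) : List SpaceCode :=
  ((families m).flatMap fun Ls ↦ (families m).map fun Hs ↦ (m, Ls, Hs)).filter fun c ↦ IsPlanar c

/-- See `PlanarSpace.IsClosureMonotone`. -/
def IsClosureMonotone (c : SpaceCode) : Prop :=
  ∀ S ∈ subsets c.1, ∀ T ∈ subsets c.1, (∀ x ∈ S, x ∈ T) → ∀ x ∈ List.range c.1,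
    rank c (x :: S) = rank c S → rank c (x :: T) = rank c T

/-- See `PlanarSpace.SpansFlatThrough`. -/
def SpansFlatThrough (c : SpaceCode) (P : ℕ) (S : List ℕ) : Prop :=
  P ∉ S ∧ rank c (P :: S) = rank c S ∧ rank c S ≠ 4

/-- See `PlanarSpace.HasLocusRank`. -/
def HasLocusRank (c : SpaceCode) (P d : ℕ) : Prop :=
  (d = 4 ∧ ∀ S ∈ subsets c.1, ¬ SpansFlatThrough c P S) ∨
    ∃ A ∈ subsets c.1, ∃ B ∈ subsets c.1, SpansFlatThrough c P A ∧ SpansFlatThrough c P B ∧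
      (∀ S ∈ subsets c.1, SpansFlatThrough c P S →
        rank c (S ++ A) = rank c S ∨ rank c (S ++ B) = rank c S) ∧
      d = rank c A + rank c B - rank c (A ++ B)

/-- See `PlanarSpace.MemLocus`. -/
def MemLocus (c : SpaceCode) (P Q : ℕ) : Prop :=
  Q ≠ P ∧ ∀ S ∈ subsets c.1, SpansFlatThrough c P S → rank c (Q :: S) = rank c S

/-- See `PlanarSpace.IsDegeneration`. -/
def IsDegeneration (c : SpaceCode) (P : ℕ) (g : SpaceCode) : Prop :=
  (∀ S ∈ subsets c.1, P ∉ S → rank g S = rank c S) ∧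
    (∀ S ∈ subsets c.1, SpansFlatThrough c P S → rank g (P :: S) = rank g S) ∧
      ∀ S ∈ subsets c.1, rank g S ≤ rank c S

/-- See `PlanarSpace.IsDeletion`. -/
def IsDeletion (c : SpaceCode) (P : ℕ) (g : SpaceCode) : Prop :=
  ∀ S ∈ subsets (c.1 - 1), rank g S = rank c (S.map fun x ↦ if x < P then x else x + 1)

/-- See `PlanarSpace.Isomorphic`; a bijection is given by the list of its values. -/
def Isomorphic (c d : SpaceCode) : Prop :=
  c.1 = d.1 ∧ ∃ ρ ∈ tuples c.1 c.1, ∀ S ∈ subsets c.1,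
    rank d (S.map fun x ↦ ρ.getD x 0) = rank c S

open Classical in
/-- The pairs `(P, d)` of a point and the rank of its locus. -/
noncomputable def locusRanks (c : SpaceCode) : List (ℕ × ℕ) :=
  ((List.range c.1).flatMap fun P ↦ (List.range 7).map fun d ↦ (P, d)).filter
    fun y ↦ HasLocusRank c y.1 y.2

open Classical in
/-- The proper degenerations of `c` at `P`, with sign `-1`. -/
noncomputable def degenerationTerms (c : SpaceCode) (P : ℕ) : List WeightedCode :=
  ((all c.1).filter fun g ↦ IsDegeneration c P g ∧ g ≠ c).map fun g ↦ (1, 0, g)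

open Classical in
/-- The deletion of `P` from `c`, once for each point in the locus of `P` in a realization of the
deletion: the locus has `1 + q + … + q ^ (d - 1)` points, from which those of `c` are taken away. -/
noncomputable def deletionTerms (c : SpaceCode) (P d : ℕ) : List WeightedCode :=
  ((all (c.1 - 1)).filter fun g ↦ IsDeletion c P g).flatMap fun g ↦
    (List.range d).map (fun i ↦ (0, i, g)) ++
      ((List.range c.1).filter fun Q ↦ MemLocus c P Q).map fun _ ↦ (1, 0, g)

open Classical in
/-- Weighted codes with fewer points or smaller ranks and with the same total number of
realizations as `c`, if `c` has a point with a locus rank; else `c` itself, or no terms if `c` has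
no realizations for lack of monotonicity. -/
noncomputable def decompose (c : SpaceCode) : List WeightedCode :=
  if IsClosureMonotone c then
    if locusRanks c = [] then [(0, 0, c)]
    else degenerationTerms c (locusRanks c).headI.1 ++
      deletionTerms c (locusRanks c).headI.1 (locusRanks c).headI.2
  else []

/-- Replace the code of a weighted code by its decomposition. -/
noncomputable def expand (t : WeightedCode) : List WeightedCode :=
  (decompose t.2.2).map fun u ↦ (t.1 + u.1, t.2.1 + u.2.1, u.2.2)

/-- A number of expansion steps after which a planar space on `m` points is decomposed into
hyperfigurations and empty spaces. -/
def expansionBound (m : ℕ) : ℕ := m + 4 * (subsets m).length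

/-- The decomposition of `c` into hyperfigurations and empty spaces. -/
noncomputable def normalForm (c : SpaceCode) : List WeightedCode :=
  (fun ts ↦ ts.flatMap expand)^[expansionBound c.1] [(0, 0, c)]

open Classical in
/-- The normal forms of the planar spaces on `n` points without full lines. -/
noncomputable def capTerms (n : ℕ) : List WeightedCode :=
  ((all n).filter fun c ↦ ∀ L ∈ c.2.1, L.length ≤ 2).flatMap normalForm

/-- The coefficients of the sum of `(-1) ^ s * X ^ e` over the terms `(s, e, c)`. -/
def coeffs (ts : List WeightedCode) : List ℤ :=
  (List.range ((ts.map fun t ↦ t.2.1).sum + 1)).map fun j ↦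
    ((ts.filter fun t ↦ t.2.1 = j ∧ t.1 % 2 = 0).length : ℤ) -
      (ts.filter fun t ↦ t.2.1 = j ∧ ¬ t.1 % 2 = 0).length

/-- The coefficients contributed by empty spaces. -/
noncomputable def constCoeffs (ts : List WeightedCode) : List ℤ :=
  coeffs (ts.filter fun t ↦ t.2.2.1 = 0)

open Classical in
/-- The coefficients contributed by the spaces isomorphic to `h`. -/
noncomputable def isoCoeffs (ts : List WeightedCode) (h : SpaceCode) : List ℤ :=
  coeffs (ts.filter fun t ↦ Isomorphic t.2.2 h)

section Primrec

variable {α : Type*} [Primcodable α]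

@[fun_prop]
theorem primrec_subsets {f : α → ℕ} (hf : Primrec f) : Primrec fun a ↦ subsets (f a) := by
  unfold subsets; fun_prop

@[fun_prop]
theorem primrec_families {f : α → ℕ} (hf : Primrec f) : Primrec fun a ↦ families (f a) := by
  unfold families; fun_prop

@[fun_prop]
theorem primrec_tuples {f g : α → ℕ} (hf : Primrec f) (hg : Primrec g) :
    Primrec fun a ↦ tuples (f a) (g a) :=
  Primrec.nat_iterate hg (.const [[]]) (.mk (by fun_prop))

@[fun_prop]
theorem primrec_rank {f : α → SpaceCode} {g : α → List ℕ} (hf : Primrec f) (hg : Primrec g) :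
    Primrec fun a ↦ rank (f a) (g a) := by
  unfold rank; fun_prop

@[fun_prop]
theorem primrecPred_isPlanar {f : α → SpaceCode} (hf : Primrec f) :
    PrimrecPred fun a ↦ IsPlanar (f a) := by
  unfold IsPlanar; fun_prop

@[fun_prop]
theorem primrec_all {f : α → ℕ} (hf : Primrec f) : Primrec fun a ↦ all (f a) := by
  unfold all; fun_prop

@[fun_prop]
theorem primrecPred_isClosureMonotone {f : α → SpaceCode} (hf : Primrec f) :
    PrimrecPred fun a ↦ IsClosureMonotone (f a) := by
  unfold IsClosureMonotone; fun_prop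

@[fun_prop]
theorem primrecPred_spansFlatThrough {f : α → SpaceCode} {g : α → ℕ} {h : α → List ℕ}
    (hf : Primrec f) (hg : Primrec g) (hh : Primrec h) :
    PrimrecPred fun a ↦ SpansFlatThrough (f a) (g a) (h a) := by
  unfold SpansFlatThrough; fun_prop

@[fun_prop]
theorem primrecPred_hasLocusRank {f : α → SpaceCode} {g h : α → ℕ} (hf : Primrec f)
    (hg : Primrec g) (hh : Primrec h) : PrimrecPred fun a ↦ HasLocusRank (f a) (g a) (h a) := by
  unfold HasLocusRank; fun_prop

@[fun_prop]
theorem primrecPred_memLocus {f : α → SpaceCode} {g h : α → ℕ} (hf : Primrec f)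
    (hg : Primrec g) (hh : Primrec h) : PrimrecPred fun a ↦ MemLocus (f a) (g a) (h a) := by
  unfold MemLocus; fun_prop

@[fun_prop]
theorem primrecPred_isDegeneration {f h : α → SpaceCode} {g : α → ℕ} (hf : Primrec f)
    (hg : Primrec g) (hh : Primrec h) : PrimrecPred fun a ↦ IsDegeneration (f a) (g a) (h a) := by
  unfold IsDegeneration; fun_prop

@[fun_prop]
theorem primrecPred_isDeletion {f h : α → SpaceCode} {g : α → ℕ} (hf : Primrec f)
    (hg : Primrec g) (hh : Primrec h) : PrimrecPred fun a ↦ IsDeletion (f a) (g a) (h a) := by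
  unfold IsDeletion; fun_prop

@[fun_prop]
theorem primrecPred_isomorphic {f g : α → SpaceCode} (hf : Primrec f) (hg : Primrec g) :
    PrimrecPred fun a ↦ Isomorphic (f a) (g a) := by
  unfold Isomorphic; fun_prop

@[fun_prop]
theorem primrec_locusRanks {f : α → SpaceCode} (hf : Primrec f) :
    Primrec fun a ↦ locusRanks (f a) := by
  unfold locusRanks; fun_prop

@[fun_prop]
theorem primrec_degenerationTerms {f : α → SpaceCode} {g : α → ℕ} (hf : Primrec f)
    (hg : Primrec g) : Primrec fun a ↦ degenerationTerms (f a) (g a) := by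
  unfold degenerationTerms; fun_prop

@[fun_prop]
theorem primrec_deletionTerms {f : α → SpaceCode} {g h : α → ℕ} (hf : Primrec f)
    (hg : Primrec g) (hh : Primrec h) : Primrec fun a ↦ deletionTerms (f a) (g a) (h a) := by
  unfold deletionTerms; fun_prop

@[fun_prop]
theorem primrec_decompose {f : α → SpaceCode} (hf : Primrec f) :
    Primrec fun a ↦ decompose (f a) := by
  unfold decompose; fun_prop

@[fun_prop]
theorem primrec_expand {f : α → WeightedCode} (hf : Primrec f) :
    Primrec fun a ↦ expand (f a) := by
  unfold expand; fun_prop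

@[fun_prop]
theorem primrec_normalForm {f : α → SpaceCode} (hf : Primrec f) :
    Primrec fun a ↦ normalForm (f a) := by
  unfold normalForm expansionBound
  exact Primrec.nat_iterate (by fun_prop) (by fun_prop) (.mk (by fun_prop))

@[fun_prop]
theorem primrec_capTerms {f : α → ℕ} (hf : Primrec f) : Primrec fun a ↦ capTerms (f a) := by
  unfold capTerms; fun_prop

@[fun_prop]
theorem primrec_coeffs {f : α → List WeightedCode} (hf : Primrec f) :
    Primrec fun a ↦ coeffs (f a) := by
  unfold coeffs; fun_prop

@[fun_prop]
theorem primrec_constCoeffs {f : α → List WeightedCode} (hf : Primrec f) :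
    Primrec fun a ↦ constCoeffs (f a) := by
  unfold constCoeffs; fun_prop

@[fun_prop]
theorem primrec_isoCoeffs {f : α → List WeightedCode} {g : α → SpaceCode} (hf : Primrec f)
    (hg : Primrec g) : Primrec fun a ↦ isoCoeffs (f a) (g a) := by
  unfold isoCoeffs; fun_prop

end Primrec

end SpaceCode

theorem sublist_eq_filter_mem {α : Type*} [DecidableEq α] {l l' : List α} (h : l'.Sublist l)
    (hl : l.Nodup) : l' = l.filter (· ∈ l') := by
  induction h with
  | slnil => rfl
  | @cons l₁ l₂ a hsub ih =>
    rw [List.nodup_cons] at hl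
    rw [List.filter_cons_of_neg (by simpa using fun h' ↦ hl.1 (hsub.subset h'))]
    exact ih hl.2
  | @cons_cons l₁ l₂ a _ ih =>
    rw [List.nodup_cons] at hl
    rw [List.filter_cons_of_pos (by simp)]
    congr 1
    refine (ih hl.2).trans (List.filter_congr fun x hx ↦ ?_)
    have : x ≠ a := fun e ↦ hl.1 (e ▸ hx)
    simp [this]

namespace SpaceCode

variable {m : ℕ}

/-- A set of points as increasing list of numbers. -/
def setCode (S : Finset (Fin m)) : List ℕ := ((List.finRange m).filter (· ∈ S)).map Fin.val

theorem mem_setCode {S : Finset (Fin m)} {x : ℕ} : x ∈ setCode S ↔ ∃ i ∈ S, i.val = x := by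
  simp [setCode]

theorem val_mem_setCode {S : Finset (Fin m)} {i : Fin m} : i.val ∈ setCode S ↔ i ∈ S := by
  simp [mem_setCode, Fin.val_inj]

theorem setCode_injective : Function.Injective (setCode : Finset (Fin m) → List ℕ) := by
  intro S T h
  ext i
  rw [← val_mem_setCode, h, val_mem_setCode]

theorem length_setCode (S : Finset (Fin m)) : (setCode S).length = S.card := by
  rw [setCode, List.length_map, ← List.toFinset_card_of_nodup ((List.nodup_finRange m).filter _)]
  congr 1
  ext i
  simp

theorem subsets_eq_map : subsets m = (List.finRange m).sublists.map (List.map Fin.val) := by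
  rw [subsets, ← List.sublists_map, List.map_coe_finRange_eq_range]

theorem map_val_of_mem_sublists {l : List (Fin m)} (h : l ∈ (List.finRange m).sublists) :
    l.map Fin.val = setCode l.toFinset := by
  rw [List.mem_sublists] at h
  rw [setCode]
  conv_lhs => rw [sublist_eq_filter_mem h (List.nodup_finRange m)]
  simp

theorem mem_subsets {l : List ℕ} : l ∈ subsets m ↔ ∃ S : Finset (Fin m), setCode S = l := by
  rw [subsets_eq_map, List.mem_map]
  constructor
  · rintro ⟨l, hl, rfl⟩
    exact ⟨_, (map_val_of_mem_sublists hl).symm⟩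
  · rintro ⟨S, rfl⟩
    exact ⟨_, List.mem_sublists.2 List.filter_sublist, rfl⟩

theorem nodup_subsets : (subsets m).Nodup := List.nodup_sublists.2 List.nodup_range

theorem length_subsets : (subsets m).length = 2 ^ m := by
  rw [subsets, List.length_sublists, List.length_range]

theorem forall_mem_subsets {p : List ℕ → Prop} :
    (∀ l ∈ subsets m, p l) ↔ ∀ S : Finset (Fin m), p (setCode S) := by
  simp [mem_subsets]

theorem exists_mem_subsets {p : List ℕ → Prop} :
    (∃ l ∈ subsets m, p l) ↔ ∃ S : Finset (Fin m), p (setCode S) := by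
  simp [mem_subsets]

theorem mem_familyCode {𝓢 : Finset (Finset (Fin m))} {l : List ℕ} :
    l ∈ familyCode 𝓢 ↔ ∃ S ∈ 𝓢, setCode S = l := by
  rw [familyCode, List.mem_map]
  constructor
  · rintro ⟨l, hl, rfl⟩
    rw [List.mem_filter] at hl
    exact ⟨_, by simpa using hl.2, (map_val_of_mem_sublists hl.1).symm⟩
  · rintro ⟨S, hS, rfl⟩
    refine ⟨_, List.mem_filter.2 ⟨List.mem_sublists.2 List.filter_sublist, ?_⟩, rfl⟩
    have : ((List.finRange m).filter (· ∈ S)).toFinset = S := by ext; simp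
    simpa [this] using hS

theorem setCode_mem_familyCode {𝓢 : Finset (Finset (Fin m))} {S : Finset (Fin m)} :
    setCode S ∈ familyCode 𝓢 ↔ S ∈ 𝓢 := by
  simp [mem_familyCode, setCode_injective.eq_iff]

theorem familyCode_sublist (𝓢 : Finset (Finset (Fin m))) : (familyCode 𝓢).Sublist (subsets m) := by
  rw [subsets_eq_map, familyCode]
  exact List.filter_sublist.map _

theorem mem_families {l : List (List ℕ)} :
    l ∈ families m ↔ ∃ 𝓢 : Finset (Finset (Fin m)), familyCode 𝓢 = l := by
  classical
  rw [families, List.mem_sublists]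
  refine ⟨fun h ↦ ⟨Finset.univ.filter fun S ↦ setCode S ∈ l, ?_⟩, ?_⟩
  · rw [sublist_eq_filter_mem h nodup_subsets,
      sublist_eq_filter_mem (familyCode_sublist _) nodup_subsets]
    refine List.filter_congr fun x hx ↦ ?_
    obtain ⟨S, rfl⟩ := mem_subsets.1 hx
    simp [setCode_mem_familyCode, hx]
  · rintro ⟨𝓢, rfl⟩
    exact familyCode_sublist 𝓢

theorem familyCode_injective :
    Function.Injective (familyCode : Finset (Finset (Fin m)) → List (List ℕ)) := by
  intro 𝓢 𝓣 h
  ext S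
  rw [← setCode_mem_familyCode, h, setCode_mem_familyCode]

theorem code_injective : Function.Injective (PlanarSpace.code : PlanarSpace m → SpaceCode) := by
  intro f g h
  simp only [PlanarSpace.code, Prod.mk.injEq, true_and] at h
  exact PlanarSpace.ext (familyCode_injective h.1) (familyCode_injective h.2)

theorem forall_mem_familyCode {𝓢 : Finset (Finset (Fin m))} {p : List ℕ → Prop} :
    (∀ l ∈ familyCode 𝓢, p l) ↔ ∀ S ∈ 𝓢, p (setCode S) := by
  simp [mem_familyCode]

theorem exists_mem_familyCode {𝓢 : Finset (Finset (Fin m))} {p : List ℕ → Prop} :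
    (∃ l ∈ familyCode 𝓢, p l) ↔ ∃ S ∈ 𝓢, p (setCode S) := by
  simp [mem_familyCode]

theorem forall_mem_range {p : ℕ → Prop} : (∀ x ∈ List.range m, p x) ↔ ∀ i : Fin m, p i := by
  simp [Fin.forall_iff]

theorem forall_mem_setCode {S T : Finset (Fin m)} :
    (∀ x ∈ setCode S, x ∈ setCode T) ↔ S ⊆ T := by
  simp only [mem_setCode (S := S), forall_exists_index, and_imp, forall_apply_eq_imp_iff₂,
    val_mem_setCode]
  rfl

theorem isPlanar_iff {𝓛 𝓗 : Finset (Finset (Fin m))} :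
    IsPlanar (m, familyCode 𝓛, familyCode 𝓗) ↔
      ∃ f : PlanarSpace m, f.lines = 𝓛 ∧ f.planes = 𝓗 := by
  simp only [IsPlanar, forall_mem_familyCode, exists_mem_familyCode, forall_mem_range,
    forall_mem_setCode, val_mem_setCode, length_setCode, setCode_injective.eq_iff, ne_eq,
    Fin.val_inj]
  constructor
  · rintro ⟨htwo, hline, hplane, hnoncoll⟩
    refine ⟨⟨𝓛, 𝓗, htwo, fun a b hab ↦ ?_, fun a b c hab hac hbc hn ↦ ?_, hnoncoll⟩, rfl, rfl⟩
    · obtain ⟨L, hL, hmem, h⟩ := hline a b hab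
      exact ⟨L, ⟨hL, hmem⟩, fun L' hL' ↦ h L' hL'.1 hL'.2⟩
    · obtain ⟨H, hH, hmem, h⟩ := hplane a b c hab hac hbc hn
      exact ⟨H, ⟨hH, hmem⟩, fun H' hH' ↦ h H' hH'.1 hH'.2⟩
  · rintro ⟨f, rfl, rfl⟩
    refine ⟨f.two_le_card_line, fun a b hab ↦ ?_, fun a b c hab hac hbc hn ↦ ?_,
      f.plane_noncollinear⟩
    · obtain ⟨L, ⟨hL, hmem⟩, h⟩ := f.existsUnique_line a b hab
      exact ⟨L, hL, hmem, fun L' hL' hmem' ↦ h L' ⟨hL', hmem'⟩⟩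
    · obtain ⟨H, ⟨hH, hmem⟩, h⟩ := f.existsUnique_plane a b c hab hac hbc hn
      exact ⟨H, hH, hmem, fun H' hH' hmem' ↦ h H' ⟨hH', hmem'⟩⟩

theorem mem_all {c : SpaceCode} : c ∈ all m ↔ ∃ f : PlanarSpace m, f.code = c := by
  simp only [all, List.mem_filter, List.mem_flatMap, List.mem_map, decide_eq_true_eq, mem_families]
  constructor
  · rintro ⟨⟨_, ⟨𝓛, rfl⟩, _, ⟨𝓗, rfl⟩, rfl⟩, h⟩
    obtain ⟨f, rfl, rfl⟩ := isPlanar_iff.1 h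
    exact ⟨f, rfl⟩
  · rintro ⟨f, rfl⟩
    exact ⟨⟨_, ⟨f.lines, rfl⟩, _, ⟨f.planes, rfl⟩, rfl⟩, isPlanar_iff.2 ⟨f, rfl, rfl⟩⟩

theorem nodup_all : (all m).Nodup := by
  have h : (families m).Nodup := List.nodup_sublists.2 nodup_subsets
  have hprod : ((families m).flatMap fun Ls ↦ (families m).map fun Hs ↦ (m, Ls, Hs)) =
      (families m ×ˢ families m).map (Prod.mk m) := by
    simp only [SProd.sprod, List.product, List.map_flatMap, List.map_map, Function.comp_def]
  rw [all, hprod]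
  exact ((h.product h).map (Prod.mk_right_injective m)).filter _

theorem sum_map_filter_all {M : Type*} [AddCommMonoid M] (p : SpaceCode → Prop)
    {_ : DecidablePred p} (φ : SpaceCode → M) : (((all m).filter fun c ↦ p c).map φ).sum =
      ∑ f ∈ Finset.univ.filter (fun f : PlanarSpace m ↦ p f.code), φ f.code := by
  classical
  rw [← List.sum_toFinset _ (nodup_all.filter _), ← Finset.sum_image (f := φ) code_injective.injOn]
  congr 1
  ext c
  simp only [List.mem_toFinset, List.mem_filter, mem_all, decide_eq_true_eq, Finset.mem_image,
    Finset.mem_filter, Finset.mem_univ, true_and]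
  constructor
  · rintro ⟨⟨f, rfl⟩, h⟩
    exact ⟨f, h, rfl⟩
  · rintro ⟨f, h, rfl⟩
    exact ⟨⟨f, rfl⟩, h⟩

variable {f g : PlanarSpace m} {P Q : Fin m} {S T : Finset (Fin m)}

theorem exists_mem_familyCode_forall_mem {𝓢 : Finset (Finset (Fin m))} {l : List ℕ}
    (h : ∀ x, x ∈ l ↔ ∃ i ∈ S, i.val = x) :
    (∃ L ∈ familyCode 𝓢, ∀ x ∈ l, x ∈ L) ↔ ∃ L ∈ 𝓢, S ⊆ L := by
  simp only [exists_mem_familyCode, h, forall_exists_index, and_imp, forall_apply_eq_imp_iff₂,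
    val_mem_setCode, Finset.subset_iff]

theorem rank_code {l : List ℕ} (h : ∀ x, x ∈ l ↔ ∃ i ∈ S, i.val = x) :
    rank f.code l = f.rank S := by
  have hempty : l = [] ↔ S = ∅ := by
    simp [List.eq_nil_iff_forall_not_mem, Finset.eq_empty_iff_forall_notMem, h]
  have hcard : (∀ x ∈ l, ∀ y ∈ l, x = y) ↔ S.card ≤ 1 := by
    simp only [Finset.card_le_one, h, forall_exists_index, and_imp, forall_apply_eq_imp_iff₂,
      Fin.val_inj]
  simp only [rank, PlanarSpace.rank, PlanarSpace.Coplanar, PlanarSpace.Collinear,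
    PlanarSpace.code, hempty, hcard, exists_mem_familyCode_forall_mem h, ← Finset.card_eq_zero]
  obtain h0 | h1 | h2 : S.card = 0 ∨ S.card = 1 ∨ ¬ S.card ≤ 1 := by lia
  · simp [h0]
  · simp [h1]
  · have h0 : S.card ≠ 0 := by lia
    simp only [h0, h2, if_false, false_or]
    by_cases hline : ∃ L ∈ f.lines, S ⊆ L <;> simp [hline]

theorem rank_setCode : rank f.code (setCode S) = f.rank S :=
  rank_code fun _ ↦ mem_setCode

theorem rank_cons_setCode {i : Fin m} : rank f.code (i.val :: setCode S) = f.rank (insert i S) :=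
  rank_code fun x ↦ by simp [mem_setCode, eq_comm]

theorem rank_setCode_append : rank f.code (setCode S ++ setCode T) = f.rank (S ∪ T) :=
  rank_code fun x ↦ by simp [mem_setCode, or_and_right, exists_or]

theorem rank_map_setCode {k : ℕ} {f : PlanarSpace k} {ρ : ℕ → ℕ} {φ : Fin m → Fin k}
    (h : ∀ i : Fin m, ρ i = φ i) : rank f.code ((setCode S).map ρ) = f.rank (S.image φ) :=
  rank_code fun x ↦ by simp [mem_setCode, h]

theorem code_fst : f.code.1 = m := rfl

theorem isClosureMonotone_code : IsClosureMonotone f.code ↔ f.IsClosureMonotone := by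
  simp only [IsClosureMonotone, PlanarSpace.IsClosureMonotone, code_fst,
    forall_mem_subsets, forall_mem_range, forall_mem_setCode, rank_setCode, rank_cons_setCode]

theorem spansFlatThrough_code :
    SpansFlatThrough f.code P (setCode S) ↔ f.SpansFlatThrough P S := by
  simp only [SpansFlatThrough, PlanarSpace.SpansFlatThrough, rank_setCode, rank_cons_setCode,
    val_mem_setCode]

theorem hasLocusRank_code {d : ℕ} : HasLocusRank f.code P d ↔ f.HasLocusRank P d := by
  simp only [HasLocusRank, PlanarSpace.HasLocusRank, code_fst, forall_mem_subsets,
    exists_mem_subsets, rank_setCode, rank_setCode_append, spansFlatThrough_code]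

theorem memLocus_code : MemLocus f.code P Q ↔ f.MemLocus P Q := by
  simp only [MemLocus, PlanarSpace.MemLocus, code_fst, forall_mem_subsets,
    rank_setCode, rank_cons_setCode, spansFlatThrough_code, ne_eq, Fin.val_inj]

theorem isDegeneration_code : IsDegeneration f.code P g.code ↔ f.IsDegeneration P g := by
  simp only [IsDegeneration, PlanarSpace.IsDegeneration, code_fst, forall_mem_subsets,
    rank_setCode, rank_cons_setCode, spansFlatThrough_code, val_mem_setCode]

theorem isDeletion_code {f : PlanarSpace (m + 1)} {P : Fin (m + 1)} :
    IsDeletion f.code P g.code ↔ f.IsDeletion P g := by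
  have hrank (S : Finset (Fin m)) :
      rank f.code ((setCode S).map fun x : ℕ ↦ if x < P.val then x else x + 1) =
        f.rank (S.map P.succAboveEmb) := by
    rw [Finset.map_eq_image, rank_map_setCode fun i ↦ ?_]
    rw [Fin.coe_succAboveEmb, Fin.succAbove, apply_ite Fin.val]
    rfl
  simp only [IsDeletion, PlanarSpace.IsDeletion, code_fst, Nat.add_sub_cancel, forall_mem_subsets,
    rank_setCode, hrank]

theorem mem_tuples {k : ℕ} {l : List ℕ} : l ∈ tuples m k ↔ l.length = k ∧ ∀ x ∈ l, x < m := by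
  induction k generalizing l with
  | zero => simp +contextual [tuples]
  | succ k ih =>
    have hsucc : tuples m (k + 1) =
        (tuples m k).flatMap fun l ↦ (List.range m).map fun x ↦ x :: l :=
      Function.iterate_succ_apply' _ _ _
    simp only [hsucc, List.mem_flatMap, List.mem_map, List.mem_range, ih]
    constructor
    · rintro ⟨l, ⟨hlen, hlt⟩, x, hx, rfl⟩
      simpa [hlen, hx] using hlt
    · rintro ⟨hlen, hlt⟩
      obtain ⟨x, l, rfl⟩ := List.exists_cons_of_length_eq_add_one hlen
      rw [List.forall_mem_cons] at hlt
      exact ⟨l, ⟨Nat.succ.inj hlen, hlt.2⟩, x, hlt.1, rfl⟩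

theorem exists_fun_of_mem_tuples {l : List ℕ} (hl : l ∈ tuples m m) :
    ∃ φ : Fin m → Fin m, ∀ i : Fin m, l.getD i 0 = φ i := by
  obtain ⟨hlen, hlt⟩ := mem_tuples.1 hl
  refine ⟨fun i ↦ ⟨l[i], hlt _ (List.getElem_mem _)⟩, fun i ↦ ?_⟩
  exact List.getD_eq_getElem _ _ (by lia)

theorem exists_mem_tuples_of_fun (φ : Fin m → Fin m) :
    ∃ l ∈ tuples m m, ∀ i : Fin m, l.getD i 0 = φ i :=
  ⟨List.ofFn fun i ↦ (φ i).val, mem_tuples.2 ⟨by simp, by simp [List.mem_ofFn]⟩, fun i ↦ by simp⟩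

theorem isomorphic_code : Isomorphic f.code g.code ↔ f.Isomorphic g := by
  rw [PlanarSpace.isomorphic_iff_exists_rank_image_eq]
  simp only [Isomorphic, code_fst, true_and, forall_mem_subsets, rank_setCode]
  constructor
  · rintro ⟨l, hl, h⟩
    obtain ⟨φ, hφ⟩ := exists_fun_of_mem_tuples hl
    exact ⟨φ, fun S ↦ by rw [← h, rank_map_setCode hφ]⟩
  · rintro ⟨φ, h⟩
    obtain ⟨l, hl, hφ⟩ := exists_mem_tuples_of_fun φ
    exact ⟨l, hl, fun S ↦ by rw [← h, rank_map_setCode hφ]⟩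

end SpaceCode

theorem sum_map_flatMap {α β M : Type*} [AddMonoid M] (l : List α) (g : α → List β) (φ : β → M) :
    ((l.flatMap g).map φ).sum = (l.map fun x ↦ ((g x).map φ).sum).sum := by
  rw [List.map_flatMap, List.flatMap, List.sum_flatten, List.map_map]
  rfl

theorem sum_map_range {M : Type*} [AddCommMonoid M] (n : ℕ) (φ : ℕ → M) :
    ((List.range n).map φ).sum = ∑ i ∈ Finset.range n, φ i := rfl

namespace PlanarSpace

variable {m : ℕ}

/-- The measure that decreases when `f` is replaced by a proper degeneration or a deletion. -/
noncomputable def complexity (f : PlanarSpace m) : ℕ := m + ∑ S, f.rank S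

theorem complexity_le_expansionBound (f : PlanarSpace m) :
    f.complexity ≤ SpaceCode.expansionBound m := by
  have : ∑ S, f.rank S ≤ _ :=
    Finset.sum_le_card_nsmul Finset.univ f.rank 4 fun _ _ ↦ rank_le_four
  rw [Finset.card_univ, Fintype.card_finset, Fintype.card_fin, smul_eq_mul] at this
  rw [complexity, SpaceCode.expansionBound, SpaceCode.length_subsets]
  lia

theorem IsDegeneration.complexity_lt {f g : PlanarSpace m} {P : Fin m} (h : f.IsDegeneration P g)
    (hne : g ≠ f) : g.complexity < f.complexity := by
  refine Nat.add_lt_add_left (Finset.sum_lt_sum (fun S _ ↦ h.2.2 S) ?_) _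
  by_contra! hle
  exact hne (rank_injective (funext fun S ↦ (h.2.2 S).antisymm (hle S (Finset.mem_univ _))))

theorem IsDeletion.complexity_lt {f : PlanarSpace (m + 1)} {g : PlanarSpace m} {P : Fin (m + 1)}
    (h : f.IsDeletion P g) : g.complexity < f.complexity := by
  have hsum : ∑ S, g.rank S ≤ ∑ S, f.rank S := by
    rw [Finset.sum_congr rfl fun S _ ↦ h S]
    exact (Finset.sum_map Finset.univ (Finset.mapEmbedding P.succAboveEmb).toEmbedding
      f.rank).ge.trans (Finset.sum_le_sum_of_subset (Finset.subset_univ _))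
  unfold complexity
  lia

theorem HasLocusRank.lt_seven {f : PlanarSpace m} {P : Fin m} {d : ℕ} (h : f.HasLocusRank P d) :
    d < 7 := by
  rcases h with ⟨rfl, -⟩ | ⟨A, B, hA, hB, -, rfl⟩
  · norm_num
  · have := hA.rank_eq
    have := hB.rank_eq
    lia

end PlanarSpace

namespace SpaceCode

variable {m n k : ℕ} {f : PlanarSpace m} {c : SpaceCode} {t u : WeightedCode}
  {ts : List WeightedCode}

theorem mem_locusRanks {P : Fin m} {d : ℕ} :
    (P.val, d) ∈ locusRanks f.code ↔ f.HasLocusRank P d := by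
  simp only [locusRanks, List.mem_filter, List.mem_flatMap, List.mem_map, List.mem_range,
    decide_eq_true_eq, Prod.mk.injEq, hasLocusRank_code, and_iff_right_iff_imp]
  exact fun h ↦ ⟨P, P.2, d, h.lt_seven, rfl, rfl⟩

theorem exists_hasLocusRank_of_locusRanks_ne_nil (h : locusRanks f.code ≠ []) :
    ∃ (P : Fin m) (d : ℕ), (locusRanks f.code).headI = (P.val, d) ∧ f.HasLocusRank P d := by
  have hmem : (locusRanks f.code).headI ∈ locusRanks f.code := by
    obtain ⟨y, l, hl⟩ := List.exists_cons_of_ne_nil h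
    simp [hl]
  obtain ⟨P, hP, d, hPd⟩ :
      ∃ P < m, ∃ d, (P, d) = (locusRanks f.code).headI := by
    have := hmem
    simp only [locusRanks, List.mem_filter, List.mem_flatMap, List.mem_map, List.mem_range] at this
    obtain ⟨⟨P, hP, d, -, hPd⟩, -⟩ := this
    exact ⟨P, hP, d, hPd⟩
  exact ⟨⟨P, hP⟩, d, hPd.symm, mem_locusRanks.1 (hPd ▸ hmem)⟩

section Value

variable (F : Type u) [Field F]

/-- The number of strong realizations of the planar space with code `c`. -/
noncomputable def realizationCount (c : SpaceCode) : ℕ :=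
  Nat.card {σ : Fin c.1 → P3 F // ∀ S, pointRank σ S = rank c (setCode S)}

theorem realizationCount_code (f : PlanarSpace m) :
    realizationCount F f.code = f.realizationCount F :=
  Nat.card_congr <| Equiv.subtypeEquivRight fun σ : Fin m → P3 F ↦ by
    rw [PlanarSpace.isStrongRealization_iff_pointRank]
    exact forall_congr' fun S : Finset (Fin m) ↦
      iff_of_eq (congrArg (pointRank σ S = ·) rank_setCode)

/-- The polynomial factor of a weighted code. -/
noncomputable def weight (t : WeightedCode) : ℤ[X] := C ((-1) ^ t.1) * X ^ t.2.1

/-- The number that a weighted code stands for. -/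
noncomputable def value [Fintype F] (t : WeightedCode) : ℤ :=
  (weight t).eval (Fintype.card F : ℤ) * realizationCount F t.2.2

open Classical in
theorem length_filter_memLocus {P : Fin m} :
    ((List.range m).filter fun Q ↦ MemLocus f.code P Q).length =
      (Finset.univ.filter (f.MemLocus P)).card := by
  rw [← List.toFinset_card_of_nodup (List.nodup_range.filter _), ← Finset.card_map Fin.valEmbedding]
  congr 1
  ext x
  simp only [List.mem_toFinset, List.mem_filter, List.mem_range, decide_eq_true_eq,
    Finset.mem_map, Finset.mem_filter, Finset.mem_univ, true_and, Fin.valEmbedding_apply]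
  constructor
  · rintro ⟨hx, h⟩
    exact ⟨⟨x, hx⟩, memLocus_code.1 h, rfl⟩
  · rintro ⟨i, hi, rfl⟩
    exact ⟨i.2, memLocus_code.2 hi⟩

variable [Fintype F]

open Classical in
theorem sum_value_degenerationTerms (f : PlanarSpace m) (P : Fin m) :
    ((degenerationTerms f.code P).map (value F)).sum = f.realizationCount F -
      ∑ g ∈ Finset.univ.filter (f.IsDegeneration P), (g.realizationCount F : ℤ) := by
  have hself : f ∈ Finset.univ.filter (f.IsDegeneration P) := by
    simpa using PlanarSpace.isDegeneration_self
  rw [← neg_sub, ← Finset.sum_erase_eq_sub hself, ← Finset.sum_neg_distrib, degenerationTerms,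
    List.map_map, code_fst, sum_map_filter_all]
  refine Finset.sum_congr ?_ fun g _ ↦ ?_
  · ext g
    simp [isDegeneration_code, code_injective.eq_iff, and_comm]
  · simp [value, weight, realizationCount_code]

open Classical in
theorem sum_value_deletionTerms (f : PlanarSpace (m + 1)) (P : Fin (m + 1)) (d : ℕ) :
    ((deletionTerms f.code P d).map (value F)).sum =
      (∑ i ∈ Finset.range d, (Fintype.card F : ℤ) ^ i - (Finset.univ.filter (f.MemLocus P)).card) *
        ∑ g ∈ Finset.univ.filter (f.IsDeletion P), (g.realizationCount F : ℤ) := by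
  rw [deletionTerms, sum_map_flatMap, code_fst, Nat.add_sub_cancel, sum_map_filter_all,
    Finset.mul_sum]
  refine Finset.sum_congr (by simp only [isDeletion_code]) fun g _ ↦ ?_
  rw [List.map_append, List.sum_append, List.map_map, List.map_map, sum_map_range,
    Function.comp_def (value F) fun _ ↦ (1, 0, g.code), List.map_const', List.sum_replicate,
    length_filter_memLocus, sub_mul, Finset.sum_mul]
  simp [value, weight, realizationCount_code, sub_eq_add_neg]

theorem sum_value_decompose (f : PlanarSpace m) :
    ((decompose f.code).map (value F)).sum = f.realizationCount F := by
  classical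
  unfold decompose
  split_ifs with hmono hnil
  · simp [value, weight, realizationCount_code]
  · obtain ⟨P, d, hhead, hd⟩ := exists_hasLocusRank_of_locusRanks_ne_nil hnil
    obtain _ | m := m
    · exact P.elim0
    have hcount := congrArg (Nat.cast : ℕ → ℤ) (hd.sum_realizationCount_isDegeneration (F := F))
    push_cast [Nat.card_eq_fintype_card] at hcount
    rw [hhead, List.map_append, List.sum_append, sum_value_degenerationTerms,
      sum_value_deletionTerms]
    linear_combination -hcount
  · have : IsEmpty {σ : Fin m → P3 F // f.IsStrongRealization σ} :=
      ⟨fun σ ↦ hmono (isClosureMonotone_code.2 σ.2.isClosureMonotone)⟩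
    simp [PlanarSpace.realizationCount]

theorem sum_value_expand (s e : ℕ) (f : PlanarSpace m) :
    ((expand (s, e, f.code)).map (value F)).sum = value F (s, e, f.code) := by
  have hvalue (u : WeightedCode) : value F (s + u.1, e + u.2.1, u.2.2) =
      (-1) ^ s * (Fintype.card F : ℤ) ^ e * value F u := by
    simp only [value, weight, pow_add, eval_mul, eval_pow, eval_C, eval_X]
    ring
  simp only [expand, List.map_map, Function.comp_def, hvalue, List.sum_map_mul_left,
    sum_value_decompose]
  simp [value, weight, realizationCount_code]

end Value

/-- The decomposition of `c` consists of `c` itself. -/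
def IsIrreducible (c : SpaceCode) : Prop := IsClosureMonotone c ∧ locusRanks c = []

theorem IsIrreducible.isHyperfiguration (h : IsIrreducible f.code) : f.IsHyperfiguration := by
  intro P
  by_contra hP
  obtain ⟨d, hd⟩ := (isClosureMonotone_code.1 h.1).exists_hasLocusRank hP
  exact List.ne_nil_of_mem (mem_locusRanks.2 hd) h.2

/-- `c` is the code of a planar space on at most `n` points that is irreducible or has complexity
at most `k`; hence `k` expansions decompose it into irreducible and empty spaces. -/
def ReducesWithin (n k : ℕ) (c : SpaceCode) : Prop :=
  ∃ m ≤ n, ∃ f : PlanarSpace m, f.code = c ∧ (IsIrreducible c ∨ f.complexity ≤ k)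

theorem reducesWithin_expansionBound (f : PlanarSpace m) :
    ReducesWithin m (expansionBound f.code.1) f.code :=
  ⟨m, le_rfl, f, rfl, .inr f.complexity_le_expansionBound⟩

theorem reducesWithin_of_complexity_le (hm : m ≤ n) (hk : f.complexity ≤ k) :
    ReducesWithin n k f.code :=
  ⟨m, hm, f, rfl, .inr hk⟩

theorem ReducesWithin.exists_isHyperfiguration (h : ReducesWithin n 0 c) :
    ∃ m ≤ n, ∃ f : PlanarSpace m, f.code = c ∧ f.IsHyperfiguration := by
  obtain ⟨m, hm, f, rfl, hirr | h0⟩ := h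
  · exact ⟨m, hm, f, rfl, hirr.isHyperfiguration⟩
  · obtain rfl : m = 0 := by
      unfold PlanarSpace.complexity at h0
      lia
    exact ⟨0, hm, f, rfl, fun P ↦ P.elim0⟩

theorem reducesWithin_of_mem_degenerationTerms {P : Fin m} (hm : m ≤ n) (hk : f.complexity ≤ k + 1)
    (ht : t ∈ degenerationTerms f.code P) : ReducesWithin n k t.2.2 := by
  simp only [degenerationTerms, List.mem_map, List.mem_filter, decide_eq_true_eq, code_fst] at ht
  obtain ⟨_, ⟨hc, hdeg, hne⟩, rfl⟩ := ht
  obtain ⟨g, rfl⟩ := mem_all.1 hc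
  have := (isDegeneration_code.1 hdeg).complexity_lt (code_injective.ne_iff.1 hne)
  exact reducesWithin_of_complexity_le hm (by lia)

theorem reducesWithin_of_mem_deletionTerms {f : PlanarSpace (m + 1)} {P : Fin (m + 1)} {d : ℕ}
    (hm : m + 1 ≤ n) (hk : f.complexity ≤ k + 1) (ht : t ∈ deletionTerms f.code P d) :
    ReducesWithin n k t.2.2 := by
  simp only [deletionTerms, List.mem_flatMap, List.mem_filter, decide_eq_true_eq, code_fst,
    Nat.add_sub_cancel, List.mem_append, List.mem_map] at ht
  obtain ⟨c, ⟨hc, hdel⟩, ht⟩ := ht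
  obtain ⟨g, rfl⟩ := mem_all.1 hc
  have hcode : t.2.2 = g.code := by rcases ht with ⟨_, -, rfl⟩ | ⟨_, -, rfl⟩ <;> rfl
  have := (isDeletion_code.1 hdel).complexity_lt
  exact hcode ▸ reducesWithin_of_complexity_le (by lia) (by lia)

theorem ReducesWithin.of_mem_decompose (h : ReducesWithin n (k + 1) c) (ht : t ∈ decompose c) :
    ReducesWithin n k t.2.2 := by
  obtain ⟨m, hm, f, rfl, h⟩ := h
  unfold decompose at ht
  split_ifs at ht with hmono hnil
  · rw [List.mem_singleton] at ht
    exact ⟨m, hm, f, by rw [ht], .inl (ht ▸ ⟨hmono, hnil⟩)⟩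
  · have hk : f.complexity ≤ k + 1 := h.resolve_left fun h ↦ hnil h.2
    obtain ⟨P, d, hhead, -⟩ := exists_hasLocusRank_of_locusRanks_ne_nil hnil
    obtain _ | m := m
    · exact P.elim0
    rw [hhead, List.mem_append] at ht
    exact ht.elim (reducesWithin_of_mem_degenerationTerms hm hk)
      (reducesWithin_of_mem_deletionTerms hm hk)
  · simp at ht

theorem ReducesWithin.of_mem_expand (h : ReducesWithin n (k + 1) t.2.2) (hu : u ∈ expand t) :
    ReducesWithin n k u.2.2 := by
  obtain ⟨v, hv, rfl⟩ := List.mem_map.1 hu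
  exact h.of_mem_decompose (t := v) hv

theorem reducesWithin_of_mem_iterate_expand (h : ∀ t ∈ ts, ReducesWithin n k t.2.2) :
    ∀ u ∈ (fun ts ↦ ts.flatMap expand)^[k] ts, ReducesWithin n 0 u.2.2 := by
  induction k generalizing ts with
  | zero => exact h
  | succ k ih =>
    rw [Function.iterate_succ_apply]
    refine ih fun u hu ↦ ?_
    obtain ⟨t, ht, hu⟩ := List.mem_flatMap.1 hu
    exact (h t ht).of_mem_expand hu

theorem sum_value_iterate_expand (F : Type u) [Field F] [Fintype F]
    (h : ∀ t ∈ ts, ReducesWithin n k t.2.2) :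
    (((fun ts ↦ ts.flatMap expand)^[k] ts).map (value F)).sum = (ts.map (value F)).sum := by
  induction k generalizing ts with
  | zero => rfl
  | succ k ih =>
    rw [Function.iterate_succ_apply, ih, sum_map_flatMap]
    · refine congrArg List.sum (List.map_congr_left fun ⟨s, e, c⟩ ht ↦ ?_)
      obtain ⟨m, -, f, rfl, -⟩ := h _ ht
      exact sum_value_expand F s e f
    · intro u hu
      obtain ⟨t, ht, hu⟩ := List.mem_flatMap.1 hu
      exact (h t ht).of_mem_expand hu

/-- All terms are hyperfigurations on at most `n` points; this includes the empty planar space,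
which satisfies `PlanarSpace.IsHyperfiguration` vacuously. -/
def IsReduced (n : ℕ) (ts : List WeightedCode) : Prop :=
  ∀ t ∈ ts, ∃ m ≤ n, ∃ f : PlanarSpace m, f.code = t.2.2 ∧ f.IsHyperfiguration

theorem isReduced_normalForm (f : PlanarSpace m) : IsReduced m (normalForm f.code) := fun t ht ↦
  (reducesWithin_of_mem_iterate_expand (by simpa using reducesWithin_expansionBound f) t
    ht).exists_isHyperfiguration

theorem sum_value_normalForm (F : Type u) [Field F] [Fintype F] (f : PlanarSpace m) :
    ((normalForm f.code).map (value F)).sum = f.realizationCount F := by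
  rw [normalForm, sum_value_iterate_expand F (n := m)]
  · simp [value, weight, realizationCount_code]
  · simpa using reducesWithin_expansionBound f

end SpaceCode

theorem polyOfCoeffs_map_range (n : ℕ) (a : ℕ → ℤ) :
    polyOfCoeffs ((List.range n).map a) = ∑ j ∈ Finset.range n, C (a j) * X ^ j := by
  induction n generalizing a with
  | zero => rfl
  | succ n ih =>
    have hcons : polyOfCoeffs ((List.range (n + 1)).map a) =
        C (a 0) + X * polyOfCoeffs ((List.range n).map fun j ↦ a (j + 1)) := by
      rw [List.range_succ_eq_map, List.map_cons, List.map_map]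
      rfl
    rw [hcons, ih, Finset.sum_range_succ', Finset.mul_sum, pow_zero, mul_one, add_comm]
    exact congrArg (· + _) (Finset.sum_congr rfl fun j _ ↦ by ring)

namespace SpaceCode

variable {m n k : ℕ} {f : PlanarSpace m} {ts : List WeightedCode}

theorem coeff_sum_map_weight (ts : List WeightedCode) (j : ℕ) :
    (ts.map weight).sum.coeff j =
      ((ts.filter fun t ↦ t.2.1 = j ∧ t.1 % 2 = 0).length : ℤ) -
        (ts.filter fun t ↦ t.2.1 = j ∧ ¬ t.1 % 2 = 0).length := by
  induction ts with
  | nil => simp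
  | cons t ts ih =>
    rw [List.map_cons, List.sum_cons, coeff_add, ih, weight, coeff_C_mul_X_pow, List.filter_cons,
      List.filter_cons]
    by_cases hj : t.2.1 = j
    · rcases Nat.even_or_odd t.1 with hs | hs
      · simp only [hj, hs.neg_one_pow, Nat.even_iff.1 hs, ↓reduceIte, and_self, decide_true,
          not_true_eq_false, and_false, decide_false, Bool.false_eq_true, List.length_cons,
          Nat.cast_succ]
        ring
      · simp only [hj, hs.neg_one_pow, Nat.odd_iff.1 hs, one_ne_zero, ↓reduceIte, and_self,
          decide_true, not_false_eq_true, and_false, decide_false, Bool.false_eq_true,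
          List.length_cons, Nat.cast_succ]
        ring
    · simp [hj, Ne.symm hj]

theorem natDegree_sum_map_weight_le (ts : List WeightedCode) :
    (ts.map weight).sum.natDegree ≤ (ts.map fun t ↦ t.2.1).sum := by
  induction ts with
  | nil => simp
  | cons t ts ih =>
    rw [List.map_cons, List.map_cons, List.sum_cons, List.sum_cons]
    exact (natDegree_add_le _ _).trans <|
      max_le ((natDegree_C_mul_X_pow_le _ _).trans (Nat.le_add_right _ _))
        (ih.trans (Nat.le_add_left _ _))

theorem polyOfCoeffs_coeffs (ts : List WeightedCode) :
    polyOfCoeffs (coeffs ts) = (ts.map weight).sum := by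
  rw [coeffs, polyOfCoeffs_map_range]
  simp only [← coeff_sum_map_weight]
  exact (as_sum_range_C_mul_X_pow' _ (Nat.lt_succ_of_le (natDegree_sum_map_weight_le ts))).symm

/-- `c` is the code of a hyperfiguration in the class `h`. -/
def Represents (c : SpaceCode) (h : HyperfigurationClass k) : Prop :=
  ∃ g : Hyperfiguration k, g.1.code = c ∧ HyperfigurationClass.mk g = h

theorem Represents.fst_eq {c : SpaceCode} {h : HyperfigurationClass k} (hc : Represents c h) :
    c.1 = k := by
  obtain ⟨g, rfl, -⟩ := hc
  rfl

theorem represents_code_iff {g : Hyperfiguration k} {h : HyperfigurationClass k} :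
    Represents g.1.code h ↔ h = .mk g := by
  constructor
  · rintro ⟨g', hcode, rfl⟩
    rw [Subtype.ext (code_injective hcode)]
  · rintro rfl
    exact ⟨g, rfl, rfl⟩

theorem isomorphic_iff_represents {g : PlanarSpace m} (hg : g.IsHyperfiguration)
    {h : Hyperfiguration k} :
    Isomorphic g.code h.1.code ↔ Represents g.code (.mk h : HyperfigurationClass k) := by
  by_cases hmk : m = k
  · subst hmk
    rw [isomorphic_code, represents_code_iff (g := ⟨g, hg⟩), eq_comm]
    exact (Quotient.eq (r := hyperfigurationSetoid m) (x := ⟨g, hg⟩)).symm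
  · exact iff_of_false (fun hiso ↦ hmk hiso.1) fun hrep ↦ hmk hrep.fst_eq

/-- The sum of the weights of the terms without points. -/
noncomputable def constPoly (ts : List WeightedCode) : ℤ[X] :=
  ((ts.filter fun t ↦ t.2.2.1 = 0).map weight).sum

open Classical in
/-- The sum of the weights of the terms that represent `h`. -/
noncomputable def classPoly (ts : List WeightedCode) (k : ℕ) (h : HyperfigurationClass k) : ℤ[X] :=
  ((ts.filter fun t ↦ Represents t.2.2 h).map weight).sum

theorem polyOfCoeffs_constCoeffs (ts : List WeightedCode) :
    polyOfCoeffs (constCoeffs ts) = constPoly ts := polyOfCoeffs_coeffs _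

theorem IsReduced.polyOfCoeffs_isoCoeffs (hts : IsReduced n ts) (h : Hyperfiguration k) :
    polyOfCoeffs (isoCoeffs ts h.1.code) = classPoly ts k (.mk h) := by
  rw [isoCoeffs, polyOfCoeffs_coeffs, classPoly]
  congr 2
  refine List.filter_congr fun t ht ↦ ?_
  obtain ⟨m, -, g, hcode, hg⟩ := hts t ht
  rw [decide_eq_decide, ← hcode, isomorphic_iff_represents hg]

theorem isReduced_capTerms (n : ℕ) : IsReduced n (capTerms n) := by
  intro t ht
  obtain ⟨c, hc, ht⟩ := List.mem_flatMap.1 ht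
  obtain ⟨f, rfl⟩ := mem_all.1 (List.mem_of_mem_filter hc)
  exact isReduced_normalForm f t ht

theorem sum_map_weight_filter_capTerms (n : ℕ) (p : WeightedCode → Prop) {_ : DecidablePred p} :
    (((capTerms n).filter fun t ↦ p t).map weight).sum =
      ∑ f ∈ PlanarSpace.withoutFullLines n,
        (((normalForm f.code).filter fun t ↦ p t).map weight).sum := by
  rw [capTerms, List.filter_flatMap, sum_map_flatMap, sum_map_filter_all]
  refine Finset.sum_congr ?_ fun f _ ↦ rfl
  ext f
  simp only [PlanarSpace.withoutFullLines, Finset.mem_filter, Finset.mem_univ, true_and,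
    PlanarSpace.code, forall_mem_familyCode, length_setCode]

theorem constPoly_capTerms (n : ℕ) : constPoly (capTerms n) =
    ∑ f ∈ PlanarSpace.withoutFullLines n, constPoly (normalForm f.code) :=
  sum_map_weight_filter_capTerms n _

theorem classPoly_capTerms (n k : ℕ) (h : HyperfigurationClass k) : classPoly (capTerms n) k h =
    ∑ f ∈ PlanarSpace.withoutFullLines n, classPoly (normalForm f.code) k h :=
  sum_map_weight_filter_capTerms n _

theorem realizationCount_of_isEmpty (F : Type u) [Field F] (f : PlanarSpace 0) :
    f.realizationCount F = 1 := by
  have hσ (σ : Fin 0 → P3 F) : f.IsStrongRealization σ := by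
    refine PlanarSpace.isStrongRealization_iff_pointRank.2 fun S ↦ ?_
    rw [Finset.eq_empty_of_isEmpty S, pointRank_empty, PlanarSpace.rank_of_card_le_one (by simp)]
    rfl
  rw [PlanarSpace.realizationCount, Nat.card_congr (Equiv.subtypeUnivEquiv hσ),
    Nat.card_eq_one_iff_unique]
  exact ⟨inferInstance, inferInstance⟩

section HyperfigurationSum

variable (F : Type u) [Field F] [Fintype F]

theorem hyperfigurationSum_zero (n : ℕ) : hyperfigurationSum n 0 0 F = 0 := by
  simp [hyperfigurationSum]

theorem hyperfigurationSum_add (n : ℕ) (p p' : ℤ[X])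
    (ph ph' : ∀ k : ℕ, HyperfigurationClass k → ℤ[X]) :
    hyperfigurationSum n (p + p') (ph + ph') F =
      hyperfigurationSum n p ph F + hyperfigurationSum n p' ph' F := by
  simp only [hyperfigurationSum, Pi.add_apply, eval_add, add_mul, Finset.sum_add_distrib]
  ring

theorem hyperfigurationSum_sum {ι : Type*} (n : ℕ) (s : Finset ι) (p : ι → ℤ[X])
    (ph : ι → ∀ k : ℕ, HyperfigurationClass k → ℤ[X]) :
    hyperfigurationSum n (∑ i ∈ s, p i) (∑ i ∈ s, ph i) F =
      ∑ i ∈ s, hyperfigurationSum n (p i) (ph i) F := by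
  classical
  induction s using Finset.induction_on with
  | empty => exact hyperfigurationSum_zero F n
  | insert i s hi ih => simp only [Finset.sum_insert hi, hyperfigurationSum_add, ih]

theorem hyperfigurationSum_singleton (s e : ℕ) (hm : m ≤ n) (hf : f.IsHyperfiguration) :
    hyperfigurationSum n (constPoly [(s, e, f.code)]) (classPoly [(s, e, f.code)]) F =
      value F (s, e, f.code) := by
  rw [value, realizationCount_code, hyperfigurationSum]
  rcases Nat.eq_zero_or_pos m with rfl | hpos
  · rw [Finset.sum_eq_zero, constPoly, realizationCount_of_isEmpty]
    · simp [code_fst]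
    · intro k hk
      have hrep (h : HyperfigurationClass k) : ¬ Represents f.code h := fun hr ↦
        Nat.ne_of_lt (Finset.mem_Icc.1 hk).1 hr.fst_eq
      simp [classPoly, hrep]
  · have hconst : constPoly [(s, e, f.code)] = 0 := by simp [constPoly, code_fst, hpos.ne']
    rw [hconst, eval_zero, zero_add, Finset.sum_eq_single_of_mem m (Finset.mem_Icc.2 ⟨hpos, hm⟩),
      Finset.sum_eq_single_of_mem (.mk ⟨f, hf⟩) (Finset.mem_univ _)]
    · have hrep : Represents f.code (.mk ⟨f, hf⟩ : HyperfigurationClass m) := ⟨⟨f, hf⟩, rfl, rfl⟩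
      have hcount : (.mk ⟨f, hf⟩ : HyperfigurationClass m).realizationCount F =
        f.realizationCount F := rfl
      simp [classPoly, hrep, hcount]
    · intro h _ hne
      have hrep : ¬ Represents f.code h := (represents_code_iff (g := ⟨f, hf⟩)).not.2 hne
      simp [classPoly, hrep]
    · intro k _ hne
      have hrep (h : HyperfigurationClass k) : ¬ Represents f.code h := fun hr ↦
        hne hr.fst_eq.symm
      simp [classPoly, hrep]

theorem constPoly_append (ts us : List WeightedCode) :
    constPoly (ts ++ us) = constPoly ts + constPoly us := by
  simp only [constPoly, List.filter_append, List.map_append, List.sum_append]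

theorem classPoly_append (ts us : List WeightedCode) :
    classPoly (ts ++ us) = classPoly ts + classPoly us := by
  ext1 k
  ext1 h
  simp only [classPoly, List.filter_append, List.map_append, List.sum_append, Pi.add_apply]

variable {F}

theorem IsReduced.sum_value_eq (hts : IsReduced n ts) :
    (ts.map (value F)).sum = hyperfigurationSum n (constPoly ts) (classPoly ts) F := by
  induction ts with
  | nil => exact (hyperfigurationSum_zero F n).symm
  | cons t ts ih =>
    obtain ⟨⟨m, hm, f, hcode, hf⟩, htail⟩ := List.forall_mem_cons.1 hts
    obtain ⟨s, e, c⟩ := t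
    obtain rfl : f.code = c := hcode
    rw [List.map_cons, List.sum_cons, ih htail, ← hyperfigurationSum_singleton F s e hm hf,
      ← hyperfigurationSum_add, ← constPoly_append, ← classPoly_append, List.singleton_append]

variable (F)

theorem realizationCount_eq_hyperfigurationSum (f : PlanarSpace m) :
    (f.realizationCount F : ℤ) =
      hyperfigurationSum m (constPoly (normalForm f.code)) (classPoly (normalForm f.code)) F := by
  rw [← sum_value_normalForm, (isReduced_normalForm f).sum_value_eq]

theorem capCount_eq_hyperfigurationSum (n : ℕ) :
    (capCount n F : ℤ) =
      hyperfigurationSum n (constPoly (capTerms n)) (classPoly (capTerms n)) F := by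
  have hclass : classPoly (capTerms n) =
      ∑ f ∈ PlanarSpace.withoutFullLines n, classPoly (normalForm f.code) := by
    ext1 k
    ext1 h
    simp only [classPoly_capTerms, Finset.sum_apply]
  rw [constPoly_capTerms, hclass, hyperfigurationSum_sum,
    PlanarSpace.capCount_eq_sum_realizationCount, Nat.cast_sum]
  exact Finset.sum_congr rfl fun f _ ↦ realizationCount_eq_hyperfigurationSum F f

end HyperfigurationSum

theorem algorithmicallyComputable_constPoly_capTerms :
    AlgorithmicallyComputable (fun n : ℕ ↦ n) fun n ↦ constPoly (capTerms n) :=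
  ⟨fun n ↦ constCoeffs (capTerms n), Primrec.to_comp (by fun_prop),
    fun n ↦ polyOfCoeffs_constCoeffs (capTerms n)⟩

theorem algorithmicallyComputable_classPoly_capTerms :
    AlgorithmicallyComputable
      (fun b : ℕ × (Σ k, Hyperfiguration k) ↦ (b.1, b.2.2.1.code))
      fun b ↦ classPoly (capTerms b.1) b.2.1 (.mk b.2.2) :=
  ⟨fun x ↦ isoCoeffs (capTerms x.1) x.2, Primrec.to_comp (by fun_prop),
    fun b ↦ (isReduced_capTerms b.1).polyOfCoeffs_isoCoeffs b.2.2⟩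

theorem algorithmicallyComputable_constPoly_normalForm :
    AlgorithmicallyComputable (fun b : (Σ m, PlanarSpace m) ↦ b.2.code)
      fun b ↦ constPoly (normalForm b.2.code) :=
  ⟨fun c ↦ constCoeffs (normalForm c), Primrec.to_comp (by fun_prop),
    fun b ↦ polyOfCoeffs_constCoeffs (normalForm b.2.code)⟩

theorem algorithmicallyComputable_classPoly_normalForm :
    AlgorithmicallyComputable
      (fun b : (Σ m, PlanarSpace m) × (Σ k, Hyperfiguration k) ↦ (b.1.2.code, b.2.2.1.code))
      fun b ↦ classPoly (normalForm b.1.2.code) b.2.1 (.mk b.2.2) :=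
  ⟨fun x ↦ isoCoeffs (normalForm x.1) x.2, Primrec.to_comp (by fun_prop),
    fun b ↦ (isReduced_normalForm b.1.2).polyOfCoeffs_isoCoeffs b.2.2⟩

end SpaceCode

theorem mainTheorem2 :
    ∃ (s : ℕ → ℤ[X]) (sh : ∀ n k : ℕ, HyperfigurationClass k → ℤ[X]),
      -- the formula for the number of caps
      (∀ (n : ℕ) (F : Type u) [Field F] [Fintype F],
        (capCount n F : ℤ) = hyperfigurationSum n (s n) (sh n) F) ∧
      -- the polynomials are produced by an algorithm
      AlgorithmicallyComputable (fun n : ℕ => n) s ∧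
      AlgorithmicallyComputable
        (fun b : ℕ × (Σ k, Hyperfiguration k) => (b.1, b.2.2.1.code))
        (fun b => sh b.1 b.2.1 (HyperfigurationClass.mk b.2.2)) ∧
      -- namely the following one: step 1 finds such an expression for `A_f(4, q)`, for each `f`
      ∃ (r : ∀ m : ℕ, PlanarSpace m → ℤ[X])
        (rh : ∀ m : ℕ, PlanarSpace m → ∀ k : ℕ, HyperfigurationClass k → ℤ[X]),
        (∀ (m : ℕ) (f : PlanarSpace m) (F : Type u) [Field F] [Fintype F],
          (f.realizationCount F : ℤ) = hyperfigurationSum m (r m f) (rh m f) F) ∧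
        AlgorithmicallyComputable
          (fun b : (Σ m, PlanarSpace m) => b.2.code) (fun b => r b.1 b.2) ∧
        AlgorithmicallyComputable
          (fun b : (Σ m, PlanarSpace m) × (Σ k, Hyperfiguration k) =>
            (b.1.2.code, b.2.2.1.code))
          (fun b => rh b.1.1 b.1.2 b.2.1 (HyperfigurationClass.mk b.2.2)) ∧
        -- step 2 adds the expressions for the `f` on `n` points without full lines
        (∀ (n : ℕ) (F : Type u) [Field F] [Fintype F],
          capCount n F = ∑ f ∈ PlanarSpace.withoutFullLines n, f.realizationCount F) ∧
        (∀ n : ℕ, s n = ∑ f ∈ PlanarSpace.withoutFullLines n, r n f) ∧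
        (∀ (n k : ℕ) (h : HyperfigurationClass k),
          sh n k h = ∑ f ∈ PlanarSpace.withoutFullLines n, rh n f k h) := by
  refine ⟨fun n ↦ SpaceCode.constPoly (SpaceCode.capTerms n),
    fun n ↦ SpaceCode.classPoly (SpaceCode.capTerms n),
    fun n F _ _ ↦ SpaceCode.capCount_eq_hyperfigurationSum F n,
    SpaceCode.algorithmicallyComputable_constPoly_capTerms,
    SpaceCode.algorithmicallyComputable_classPoly_capTerms,
    fun _ f ↦ SpaceCode.constPoly (SpaceCode.normalForm f.code),
    fun _ f ↦ SpaceCode.classPoly (SpaceCode.normalForm f.code),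
    fun _ f F _ _ ↦ SpaceCode.realizationCount_eq_hyperfigurationSum F f,
    SpaceCode.algorithmicallyComputable_constPoly_normalForm,
    SpaceCode.algorithmicallyComputable_classPoly_normalForm,
    fun n F _ _ ↦ PlanarSpace.capCount_eq_sum_realizationCount n F,
    SpaceCode.constPoly_capTerms, SpaceCode.classPoly_capTerms⟩
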